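/- **Model.** A finite directed network $(\mathcal V,\mathcal E)$ operates in time slots. Node $i$ can execute $C_i>0$ instructions per slot and link $(i,j)$ can transmit $C_{ij}>0$ data units per slot. Database $k$ is cached at the nodes of $\mathcal V(k)\subseteq\mathcal V$. A service $\phi$ has a database $k_\phi$, a merging ratio $\zeta_\phi>0$ (static packets per live packet), a workload $r_\phi>0$ (instructions per live packet) and a scaling factor $\xi_\phi>0$ (output packets per live packet). There are finitely many clients $c=(s,d,\phi)$. In slot $t$, $a^{(c)}(t)$ requests (live packets) of client $c$ arrive at $s$; for each $c$, $\{a^{(c)}(t)\}_{t\ge0}$ is i.i.d. and bounded with mean $\lambda^{(c)}$. A *route* for a request of $c$ consists of a processing location $p$, a walk of the live packet from $s$ to $p$, a static source $v\in\mathcal V(k_\phi)$ with a walk of the associated static packets from $v$ to $p$, and a walk of the output packets from $p$ to $d$. It is *efficient*, $\sigma\in\mathcal F_c$, if the three walks $\sigma_1,\sigma_1',\sigma_2$ are acyclic. It then loads node $i$ by $\rho_i^{(c,\sigma)}=r_\phi\mathbf 1\{p=i\}$ and link $(i,j)$ by $\rho_{ij}^{(c,\sigma)}=\mathbf 1\{(i,j)\in\sigma_1\}+\zeta_\phi\mathbf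 1\{(i,j)\in\sigma_1'\}+\xi_\phi\mathbf 1\{(i,j)\in\sigma_2\}$. The actual queues are: for each link, the transmission queue (packets waiting to cross it); for each node, the processing queue (paired live and static packets that have both reached it as their processing location) and the waiting queue (packets that have reached it as their processing location but whose associates have not). Sending the live, static or output packets of one request over a link takes $1$, $\zeta_\phi$ or $\xi_\phi$ units of work, and processing its pair takes $r_\phi$; the static packets of a request move together, and so do its output packets; the work of one operation may be spread over several slots, and an operation can start only in a slot after its predecessors are finished. A *policy* is a causal, possibly randomized rule that selects a route for each arriving request and, in each slot, divides the capacity of each node and link among the packets in its processing or transmission queue. The queues are *rate stable* if, almost surely, (number of packets in the queue at time $t$)$/t\to0$ for every actual queue. The stability region $\Lambda$ is the set of arrival vectors $\boldsymbol\lambda=(\lambda^{(c)})_c$ under which some policy makes all actual queues rate stable. **DI-DCNC.** Keep virtual queues $\tilde Q_i,\tilde Q_{ij}$, starting at $0$, with $\tilde Q_i(t+1)=[\tilde Q_i(t)-C_i+\tilde a_i(t)]^+$ and $\tilde Q_{ij}(t+1)=[\tilde Q_{ij}(t)-C_{ij}+\tilde a_{ij}(t)]^+$, where $\tilde a_i(t),\tilde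 a_{ij}(t)$ are the total loads on the node or link of the routes selected for the requests arriving in slot $t$; put $Q_i=\tilde Q_i/C_i$, $Q_{ij}=\tilde Q_{ij}/C_{ij}$. (i) *Route selection:* all requests of client $c$ arriving in slot $t$ get one route $\sigma^\star\in\arg\min_{\sigma\in\mathcal F_c}O^{(c,\sigma)}(t)$, where $$O^{(c,\sigma)}(t)=\sum_{(i,j)\in\mathcal E}\rho_{ij}^{(c,\sigma)}\frac{Q_{ij}(t)}{C_{ij}}+\sum_{i\in\mathcal V}\rho_i^{(c,\sigma)}\frac{Q_i(t)}{C_i}.$$ (ii) *Scheduling (extended nearest-to-origin):* in each slot every node and link serves its processing or transmission queue without leaving capacity idle while work remains, giving priority to the packets which have crossed the fewest edges of the augmented layered graph. In this graph, static packets first cross an edge from a common super source to their static source, processing at $p$ is an edge, and the count for a pair, and for the output packets made from it, is taken along the longest path from an origin. Among packets with equal counts, packets are served one after the other, so that at most one is left partially served. Ties are otherwise broken arbitrarily. **Theorem.** For any arrival vector $\boldsymbol\lambda\in\Lambda$, all actual queues are rate stable under DI-DCNC. -/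

import Mathlib

open MeasureTheory ProbabilityTheory Filter Topology

noncomputable section

/-! ## The network, the services and the clients -/

/-- A cache-enabled edge computing network with node set `V`, databases `K`, services `Φ` and
clients `ι`. -/
structure EdgeNetwork (V K Φ ι : Type*) where
  /-- the directed communication links `(i, j)` -/
  links : Finset (V × V)
  /-- `C_i`, instructions per slot at node `i` -/
  nodeCap : V → ℝ
  /-- `C_ij`, data units per slot on link `(i, j)`; only used on `links` -/
  linkCap : V × V → ℝ
  /-- `V(k)`, the nodes that cache database `k` (the static sources) -/
  cache : K → Set V
  /-- `k_φ`, the database used by service `φ` -/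
  object : Φ → K
  /-- `ζ_φ`, number of static packets per live packet -/
  merging : Φ → ℝ
  /-- `r_φ`, number of instructions per live packet -/
  workload : Φ → ℝ
  /-- `ξ_φ`, number of output packets per live packet -/
  scaling : Φ → ℝ
  /-- source node of a client -/
  source : ι → V
  /-- destination node of a client -/
  dest : ι → V
  /-- service requested by a client -/
  service : ι → Φ
  nodeCap_pos : ∀ i, 0 < nodeCap i
  linkCap_pos : ∀ e ∈ links, 0 < linkCap e
  merging_pos : ∀ φ, 0 < merging φ
  workload_pos : ∀ φ, 0 < workload φ
  scaling_pos : ∀ φ, 0 < scaling φ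

/-- The places where work is done: processing at a node, transmission over a link. -/
inductive Resource (V : Type*) where
  | node (i : V) : Resource V
  | link (e : V × V) : Resource V

/-- The resources which the network has. -/
def EdgeNetwork.HasResource {V K Φ ι : Type*} (N : EdgeNetwork V K Φ ι) : Resource V → Prop
  | .node _ => True
  | .link e => e ∈ N.links

/-- `C_i` or `C_ij`. -/
def EdgeNetwork.cap {V K Φ ι : Type*} (N : EdgeNetwork V K Φ ι) : Resource V → ℝ
  | .node i => N.nodeCap i
  | .link e => N.linkCap e

/-! ## Routes in the augmented layered graph -/

/-- The edges of the walk that visits the nodes of the list in turn. -/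
def hops {V : Type*} (l : List V) : List (V × V) := l.zip l.tail

/-- A route of one request in the augmented layered graph, given by the projections to the actual
network of its live, static and output walks, and the processing location `proc`. The edge from
the super static source to the selected static source (the first node of `stat`) and the
inter-layer edges at `proc` are understood. -/
structure Route (V : Type*) where
  live : List V
  stat : List V
  output : List V
  proc : V

/-- `σ` can deliver a request of client `c`: the live walk leads from the source to the processing
location, the static walk from some static source to the processing location, and the output walk
from there to the destination. -/
structure EdgeNetwork.IsRoute {V K Φ ι : Type*} (N : EdgeNetwork V K Φ ι) (c : ι) (σ : Route V) :
    Prop where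
  live_chain : σ.live.IsChain (fun i j => (i, j) ∈ N.links)
  live_head : σ.live.head? = some (N.source c)
  live_last : σ.live.getLast? = some σ.proc
  stat_chain : σ.stat.IsChain (fun i j => (i, j) ∈ N.links)
  stat_head : ∃ v ∈ N.cache (N.object (N.service c)), σ.stat.head? = some v
  stat_last : σ.stat.getLast? = some σ.proc
  output_chain : σ.output.IsChain (fun i j => (i, j) ∈ N.links)
  output_head : σ.output.head? = some σ.proc
  output_last : σ.output.getLast? = some (N.dest c)

/-- `σ ∈ F_c`: an efficient route, all three of whose walks are acyclic. -/
structure EdgeNetwork.IsStar {V K Φ ι : Type*} (N : EdgeNetwork V K Φ ι) (c : ι) (σ : Route V) :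
    Prop extends N.IsRoute c σ where
  live_nodup : σ.live.Nodup
  stat_nodup : σ.stat.Nodup
  output_nodup : σ.output.Nodup

open Classical in
/-- The loads `ρ_i` and `ρ_ij` that a request of client `c` delivered via `σ` imposes. -/
def EdgeNetwork.load {V K Φ ι : Type*} (N : EdgeNetwork V K Φ ι) (c : ι) (σ : Route V) :
    Resource V → ℝ
  | .node i => N.workload (N.service c) * (if σ.proc = i then 1 else 0)
  | .link e => (if e ∈ hops σ.live then 1 else 0)
      + N.merging (N.service c) * (if e ∈ hops σ.stat then 1 else 0)
      + N.scaling (N.service c) * (if e ∈ hops σ.output then 1 else 0)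

/-! ## The operations of a request -/

/-- The operations needed to serve a request: the successive transmissions (counted from `0`) of
its live packet, of its static packets and of its output packets, and the joint processing of the
paired live and static packets. -/
inductive Operation where
  | live (k : ℕ) : Operation
  | stat (k : ℕ) : Operation
  | proc : Operation
  | output (k : ℕ) : Operation

/-- Where an operation takes place (`none` if the route has no such operation). -/
def Route.site {V : Type*} (σ : Route V) : Operation → Option (Resource V)
  | .live k => (hops σ.live)[k]?.map Resource.link
  | .stat k => (hops σ.stat)[k]?.map Resource.link
  | .proc => some (Resource.node σ.proc)
  | .output k => (hops σ.output)[k]?.map Resource.link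

open Classical in
/-- The operations of a route. -/
def Route.operations {V : Type*} (σ : Route V) : Finset Operation :=
  (Finset.range (hops σ.live).length).image Operation.live
    ∪ (Finset.range (hops σ.stat).length).image Operation.stat
    ∪ {Operation.proc}
    ∪ (Finset.range (hops σ.output).length).image Operation.output

/-- `σ.Precedes o' o`: the operation `o'` must be finished before `o` can start. -/
def Route.Precedes {V : Type*} (σ : Route V) : Operation → Operation → Prop
  | .live j, .live k => j < k
  | .stat j, .stat k => j < k
  | .live j, .proc => j < (hops σ.live).length
  | .stat j, .proc => j < (hops σ.stat).length
  | .proc, .output _ => True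
  | .output j, .output k => j < k
  | _, _ => False

/-- The number of edges of the augmented layered graph that have been crossed by the packets which
wait for the given operation. Static packets have crossed the edge from the super static source as
well. For a pair of a live and a static packet, and for the output packets made from it, this is
the length of the longest path from an origin. -/
def Route.crossed {V : Type*} (σ : Route V) : Operation → ℕ
  | .live k => k
  | .stat k => k + 1
  | .proc => max (hops σ.live).length ((hops σ.stat).length + 1)
  | .output k => max (hops σ.live).length ((hops σ.stat).length + 1) + 1 + k

/-- The amount of work (data units or instructions) of an operation for a request of client `c`. -/
def EdgeNetwork.size {V K Φ ι : Type*} (N : EdgeNetwork V K Φ ι) (c : ι) : Operation → ℝ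
  | .live _ => 1
  | .stat _ => N.merging (N.service c)
  | .proc => N.workload (N.service c)
  | .output _ => N.scaling (N.service c)

/-! ## Controls and the actual queues -/

/-- The request number `index` among those of `client` that arrive in `slot`. -/
structure Request (ι : Type*) where
  slot : ℕ
  client : ι
  index : ℕ

/-- The decisions along one sample path: the route of each request, and the amount of work
`serve t (q, o)` which is spent in slot `t` on operation `o` of request `q`. -/
structure Control (V ι : Type*) where
  route : Request ι → Route V
  serve : ℕ → Request ι × Operation → ℝ

open Classical in
/-- The requests that arrive in the slots `0, …, t`, when `α s c` requests of client `c` arrive in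
slot `s`. -/
def arrived {ι : Type*} [Fintype ι] (α : ℕ → ι → ℕ) (t : ℕ) : Finset (Request ι) :=
  (Finset.range (t + 1) ×ˢ Finset.univ).biUnion fun p =>
    (Finset.range (α p.1 p.2)).image fun n => ⟨p.1, p.2, n⟩

/-- The work spent on an operation of a request before slot `t`. -/
def Control.work {V ι : Type*} (u : Control V ι) (t : ℕ) (x : Request ι × Operation) : ℝ :=
  ∑ s ∈ Finset.range t, u.serve s x

/-- The operation has been finished before slot `t`. -/
def EdgeNetwork.Done {V K Φ ι : Type*} (N : EdgeNetwork V K Φ ι) (u : Control V ι) (t : ℕ)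
    (x : Request ι × Operation) : Prop :=
  N.size x.1.client x.2 ≤ u.work t x

/-- All preceding operations of the request have been finished before slot `t`. -/
def EdgeNetwork.Ready {V K Φ ι : Type*} (N : EdgeNetwork V K Φ ι) (u : Control V ι) (t : ℕ)
    (x : Request ι × Operation) : Prop :=
  ∀ o, (u.route x.1).Precedes o x.2 → N.Done u t (x.1, o)

open Classical in
/-- The actual queue of a resource in slot `t`: the transmission queue of a link, or the processing
queue of a node (holding paired packets only). -/
def EdgeNetwork.queue {V K Φ ι : Type*} [Fintype ι] (N : EdgeNetwork V K Φ ι) (α : ℕ → ι → ℕ)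
    (u : Control V ι) (t : ℕ) (e : Resource V) : Finset (Request ι × Operation) :=
  ((arrived α t).biUnion fun q => (u.route q).operations.image fun o => (q, o)).filter
    fun x => (u.route x.1).site x.2 = some e ∧ N.Ready u t x ∧ ¬ N.Done u t x

/-- The live packet has reached the processing location before slot `t`. -/
def EdgeNetwork.LiveThere {V K Φ ι : Type*} (N : EdgeNetwork V K Φ ι) (u : Control V ι) (t : ℕ)
    (q : Request ι) : Prop :=
  ∀ k < (hops (u.route q).live).length, N.Done u t (q, .live k)

/-- The static packets have reached the processing location before slot `t`. -/
def EdgeNetwork.StatThere {V K Φ ι : Type*} (N : EdgeNetwork V K Φ ι) (u : Control V ι) (t : ℕ)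
    (q : Request ι) : Prop :=
  ∀ k < (hops (u.route q).stat).length, N.Done u t (q, .stat k)

open Classical in
/-- The waiting queue of node `i` in slot `t`: the unpaired packets, live or static, that have
reached their processing location `i` while their associates are in transit. -/
def EdgeNetwork.waiting {V K Φ ι : Type*} [Fintype ι] (N : EdgeNetwork V K Φ ι) (α : ℕ → ι → ℕ)
    (u : Control V ι) (t : ℕ) (i : V) : Finset (Request ι) :=
  (arrived α t).filter fun q =>
    (u.route q).proc = i ∧ Xor (N.LiveThere u t q) (N.StatThere u t q)

/-- The decisions `u` are admissible for the arrivals `α`. -/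
structure EdgeNetwork.Feasible {V K Φ ι : Type*} [Fintype ι] (N : EdgeNetwork V K Φ ι)
    (α : ℕ → ι → ℕ) (u : Control V ι) : Prop where
  isRoute : ∀ q : Request ι, q.index < α q.slot q.client → N.IsRoute q.client (u.route q)
  nonneg : ∀ t x, 0 ≤ u.serve t x
  queued : ∀ t x, u.serve t x ≠ 0 → ∃ e, x ∈ N.queue α u t e
  work_le : ∀ t x, u.work t x ≤ N.size x.1.client x.2
  capacity : ∀ t e, N.HasResource e → ∑ x ∈ N.queue α u t e, u.serve t x ≤ N.cap e

/-- All actual queues are rate stable along the sample path. -/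
structure EdgeNetwork.RateStable {V K Φ ι : Type*} [Fintype ι] (N : EdgeNetwork V K Φ ι)
    (α : ℕ → ι → ℕ) (u : Control V ι) : Prop where
  processing : ∀ i, Tendsto (fun t : ℕ => ((N.queue α u t (.node i)).card : ℝ) / t) atTop (𝓝 0)
  waiting : ∀ i, Tendsto (fun t : ℕ => ((N.waiting α u t i).card : ℝ) / t) atTop (𝓝 0)
  transmission : ∀ e ∈ N.links,
    Tendsto (fun t : ℕ => ((N.queue α u t (.link e)).card : ℝ) / t) atTop (𝓝 0)

/-! ## Policies, arrival processes and the stability region -/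

/-- A (possibly randomized) control policy: it takes a random seed and the arrivals to admissible
decisions, those of slot `t` depending only on the seed and on the arrivals up to slot `t`. -/
structure Policy {V K Φ ι : Type*} [Fintype ι] (N : EdgeNetwork V K Φ ι) where
  control : ℝ → (ℕ → ι → ℕ) → Control V ι
  feasible : ∀ s α, N.Feasible α (control s α)
  causal_route : ∀ s α β t, (∀ t' ≤ t, α t' = β t') →
    ∀ c n, (control s α).route ⟨t, c, n⟩ = (control s β).route ⟨t, c, n⟩
  causal_serve : ∀ s α β t, (∀ t' ≤ t, α t' = β t') →
    (control s α).serve t = (control s β).serve t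

/-- `a t c` is the number of requests of client `c` arriving in slot `t`: for each client i.i.d.
over time, bounded, with mean `lam c`. -/
structure IsArrivalProcess {ι Ω : Type*} [MeasurableSpace Ω] (P : Measure Ω)
    (a : ℕ → ι → Ω → ℕ) (lam : ι → ℝ) : Prop where
  measurable : ∀ t c, Measurable (a t c)
  indep : ∀ c, iIndepFun (fun t => a t c) P
  identDistrib : ∀ t c, IdentDistrib (a t c) (a 0 c) P P
  bounded : ∃ M : ℕ, ∀ t c, ∀ᵐ ω ∂P, a t c ω ≤ M
  mean : ∀ c, ∫ ω, (a 0 c ω : ℝ) ∂P = lam c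

/-- The network stability region `Λ`: the arrival vectors under which some policy, whose random
seed is independent of the arrivals, makes the actual queues rate stable almost surely. -/
def EdgeNetwork.stabilityRegion {V K Φ ι : Type*} [Fintype ι] (N : EdgeNetwork V K Φ ι) :
    Set (ι → ℝ) :=
  {lam | ∃ (Ω : Type) (_ : MeasurableSpace Ω) (P : Measure Ω) (_ : IsProbabilityMeasure P)
    (a : ℕ → ι → Ω → ℕ) (seed : Ω → ℝ) (π : Policy N),
    IsArrivalProcess P a lam ∧ Measurable seed ∧
    IndepFun seed (fun ω t c => a t c ω) P ∧
    ∀ᵐ ω ∂P, N.RateStable (fun t c => a t c ω) (π.control (seed ω) (fun t c => a t c ω))}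

/-! ## The DI-DCNC policy -/

/-- The virtual queue of a resource. -/
def EdgeNetwork.virtualQueue {V K Φ ι : Type*} [Fintype ι] (N : EdgeNetwork V K Φ ι)
    (α : ℕ → ι → ℕ) (u : Control V ι) (e : Resource V) : ℕ → ℝ
  | 0 => 0
  | t + 1 => max (N.virtualQueue α u e t - N.cap e
      + ∑ c, ∑ n ∈ Finset.range (α t c), N.load c (u.route ⟨t, c, n⟩) e) 0

/-- The normalized virtual queue of a resource. -/
def EdgeNetwork.normQueue {V K Φ ι : Type*} [Fintype ι] (N : EdgeNetwork V K Φ ι)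
    (α : ℕ → ι → ℕ) (u : Control V ι) (e : Resource V) (t : ℕ) : ℝ :=
  N.virtualQueue α u e t / N.cap e

/-- The weight `O^(c,σ)(t)` of the efficient route `σ`. -/
def EdgeNetwork.weight {V K Φ ι : Type*} [Fintype V] [Fintype ι] (N : EdgeNetwork V K Φ ι)
    (α : ℕ → ι → ℕ) (u : Control V ι) (t : ℕ) (c : ι) (σ : Route V) : ℝ :=
  ∑ e ∈ N.links, N.load c σ (.link e) * (N.normQueue α u (.link e) t / N.linkCap e)
    + ∑ i, N.load c σ (.node i) * (N.normQueue α u (.node i) t / N.nodeCap i)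

/-- Route selection: all requests of a client arriving in slot `t` get one and the same efficient
route, which has minimum weight among the efficient routes. -/
def EdgeNetwork.MinWeightRouting {V K Φ ι : Type*} [Fintype V] [Fintype ι]
    (N : EdgeNetwork V K Φ ι) (α : ℕ → ι → ℕ) (u : Control V ι) : Prop :=
  ∀ t c, ∃ σ, N.IsStar c σ ∧ (∀ τ, N.IsStar c τ → N.weight α u t c σ ≤ N.weight α u t c τ) ∧
    ∀ n < α t c, u.route ⟨t, c, n⟩ = σ

open Classical in
/-- Packet scheduling by extended nearest-to-origin. Packets that have crossed fewer edges have
priority: if an operation in a queue is not finished in slot `t`, then the whole capacity is spent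
on packets that have crossed at most as many edges. Packets are served one after the other: among
packets in a queue that have crossed equally many edges, at most one is left partially served. -/
structure EdgeNetwork.ENTO {V K Φ ι : Type*} [Fintype ι]
    (N : EdgeNetwork V K Φ ι) (α : ℕ → ι → ℕ) (u : Control V ι) : Prop where
  priority : ∀ t e, N.HasResource e → ∀ x ∈ N.queue α u t e, ¬ N.Done u (t + 1) x →
    ∑ y ∈ (N.queue α u t e).filter
      (fun y => (u.route y.1).crossed y.2 ≤ (u.route x.1).crossed x.2), u.serve t y = N.cap e
  one_by_one : ∀ t e, N.HasResource e → ∀ x ∈ N.queue α u t e, ∀ y ∈ N.queue α u t e,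
    (u.route x.1).crossed x.2 = (u.route y.1).crossed y.2 →
    0 < u.work (t + 1) x → ¬ N.Done u (t + 1) x →
    0 < u.work (t + 1) y → ¬ N.Done u (t + 1) y → x = y

/-- The policy is DI-DCNC (with any rule to break ties). -/
def Policy.IsDIDCNC {V K Φ ι : Type*} [Fintype V] [Fintype ι] {N : EdgeNetwork V K Φ ι}
    (π : Policy N) : Prop :=
  ∀ s α, N.MinWeightRouting α (π.control s α) ∧ N.ENTO α (π.control s α)

end

section Routes

open Classical

/-! ## Walks and their reduction to paths -/

/-! The argument runs along single sample paths on which the arrivals are bounded and their averages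
converge to `lam`; probability enters only through the strong law.

Stability region. Put a price `w r ≥ 0` on each unit of work at resource `r`. Under a rate stable
control all but o(T) of the requests arrived by slot `T` are delivered, since every undelivered one
has a packet in some queue. A delivered request has consumed at least the price of a cheapest
efficient route, because loops in its walks can be cut away, while at most `T * cap r` work was done
at `r`. Dividing by `T` gives `∑ lam c * m c ≤ ∑ w r * cap r` (`RateStable.sum_price_le`). This is
the dual form of the capacity constraints; no stationary randomized policy has to be constructed.

Virtual queues. The drift of the Lyapunov function ∑ (Q̃/cap)² is at most a constant plus twice the
cost of the arrivals minus the cost of the capacity, at the prices Q̃/cap². With minimum weights `m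
t c` the arrivals cost `∑ α t c * m t c`, and the dual inequality leaves only the noise `∑ (α t c -
lam c) * m t c`. The weights change by a bounded amount per slot, so summation by parts makes the
accumulated noise o(T²) (`tendsto_sum_mul_div_sq`). Hence Q̃ = o(T) (`tendsto_queue_div`).

Actual queues. Induct on the number `k` of crossed edges (`sublinear_late`). If only o(t) requests
have unfinished operations with count below `k`, the priority rule keeps the work left at counts up
to `k` below the virtual queue plus o(t) (`sum_remaining_le`). Sizes are bounded below and few
packets are partially served, so little work means few packets (`card_front_le`), which gives the
claim for `k + 1`. Efficient routes have boundedly many counts, so the induction reaches all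
packets. -/

theorem hops_cons_cons {V : Type*} (a b : V) (l : List V) :
    hops (a :: b :: l) = (a, b) :: hops (b :: l) := rfl

theorem hops_length_le {V : Type*} (l : List V) : (hops l).length ≤ l.length := by
  simp [hops, List.length_zip]

theorem List.Nodup.hops {V : Type*} {l : List V} (h : l.Nodup) : (hops l).Nodup := by
  refine List.Nodup.of_map Prod.snd ?_
  rw [_root_.hops, List.map_snd_zip (by simp)]
  exact h.sublist (List.tail_sublist l)

theorem List.IsChain.of_mem_hops {V : Type*} {R : V → V → Prop} {l : List V} (h : l.IsChain R) :
    ∀ e ∈ hops l, R e.1 e.2 := by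
  induction l with
  | nil => intro e he; simp [hops] at he
  | cons a l ih =>
    cases l with
    | nil => intro e he; simp [hops] at he
    | cons b l =>
      rw [List.isChain_cons_cons] at h
      intro e he
      rw [hops_cons_cons, List.mem_cons] at he
      rcases he with rfl | he
      · exact h.1
      · exact ih h.2 e he

theorem hops_subset_append {V : Type*} (s l : List V) : hops l ⊆ hops (s ++ l) := by
  induction s with
  | nil => simp
  | cons a s ih =>
    rw [List.cons_append]
    intro e he
    have h := ih he
    cases hsl : s ++ l with
    | nil => rw [hsl] at h; simp [hops] at h
    | cons b t =>
      rw [hops_cons_cons, ← hsl]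
      exact List.mem_cons_of_mem _ h

/-- Every walk contains an acyclic walk with the same ends. -/
theorem exists_nodup_walk {V : Type*} {R : V → V → Prop} (n : ℕ) : ∀ l : List V, l.length ≤ n →
    l.IsChain R → ∃ l' : List V, l'.Nodup ∧ l'.IsChain R ∧ l'.head? = l.head? ∧
      l'.getLast? = l.getLast? ∧ l' ⊆ l ∧ hops l' ⊆ hops l := by
  induction n with
  | zero =>
    intro l hl hc
    have : l = [] := List.length_eq_zero_iff.1 (by omega)
    subst this
    exact ⟨[], by simp⟩
  | succ n ih =>
    intro l hl hc
    cases l with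
    | nil => exact ⟨[], by simp⟩
    | cons a l =>
      -- If the first node recurs, the loop up to that recurrence is cut out. Otherwise only the
      -- tail is reduced, and `l' ⊆ l` keeps the first node from reappearing.
      by_cases ha : a ∈ l
      · obtain ⟨s, t, rfl⟩ := List.append_of_mem ha
        have hc' : (a :: t).IsChain R := by
          rw [← List.cons_append] at hc
          exact hc.right_of_append
        obtain ⟨l', h1, h2, h3, h4, h5, h6⟩ := ih (a :: t) (by simp at hl ⊢; omega) hc'
        refine ⟨l', h1, h2, h3, ?_, ?_, ?_⟩
        · rw [h4, ← List.cons_append, List.getLast?_append]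
          simp [List.getLast?_cons]
        · intro v hv
          have := h5 hv
          simp at this ⊢
          tauto
        · rw [← List.cons_append]
          exact fun e he => hops_subset_append (a :: s) (a :: t) (h6 he)
      · have hc' : l.IsChain R := hc.tail
        obtain ⟨l', h1, h2, h3, h4, h5, h6⟩ := ih l (by simpa using hl) hc'
        cases l with
        | nil => exact ⟨[a], by simp⟩
        | cons b l =>
          cases l' with
          | nil => simp at h3
          | cons b' l' =>
            obtain rfl : b' = b := by simpa using h3
            refine ⟨a :: b' :: l', ?_, ?_, rfl, ?_, ?_, ?_⟩
            · exact List.nodup_cons.2 ⟨fun h => ha (h5 h), h1⟩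
            · rw [List.isChain_cons_cons] at hc ⊢
              exact ⟨hc.1, h2⟩
            · simpa [List.getLast?_cons] using h4
            · exact List.cons_subset_cons _ h5
            · rw [hops_cons_cons, hops_cons_cons]
              exact List.cons_subset_cons _ h6

/-! ## Operations of a route -/

variable {V K Φ ι : Type*}

theorem Route.sum_operations (σ : Route V) (g : Operation → ℝ) :
    ∑ o ∈ σ.operations, g o = ∑ k ∈ Finset.range (hops σ.live).length, g (.live k)
      + ∑ k ∈ Finset.range (hops σ.stat).length, g (.stat k) + g .proc
      + ∑ k ∈ Finset.range (hops σ.output).length, g (.output k) := by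
  unfold Route.operations
  rw [Finset.sum_union, Finset.sum_union, Finset.sum_union, Finset.sum_image, Finset.sum_image,
    Finset.sum_image, Finset.sum_singleton]
  · intro x _ y _ h; simpa using h
  · intro x _ y _ h; simpa using h
  · intro x _ y _ h; simpa using h
  · rw [Finset.disjoint_left]; simp +contextual
  · rw [Finset.disjoint_right]; simp
  · rw [Finset.disjoint_left]; intro x hx
    simp only [Finset.mem_union, Finset.mem_image, Finset.mem_singleton] at hx
    rcases hx with (⟨k, _, rfl⟩ | ⟨k, _, rfl⟩) | rfl <;> simp

theorem Route.mem_operations (σ : Route V) (o : Operation) :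
    o ∈ σ.operations ↔ match o with
      | .live k => k < (hops σ.live).length
      | .stat k => k < (hops σ.stat).length
      | .proc => True
      | .output k => k < (hops σ.output).length := by
  cases o <;> simp [Route.operations]

/-- Counting along the longest path makes the count strictly increasing along precedence, also where
the live and static walks merge. All inductions on counts rest on this. -/
theorem Route.Precedes.crossed_lt {σ : Route V} {o' o : Operation} (h : σ.Precedes o' o) :
    σ.crossed o' < σ.crossed o := by
  cases o' <;> cases o <;> simp only [Route.Precedes] at h <;> simp only [Route.crossed] <;> omega

theorem Route.Precedes.mem_operations {σ : Route V} {o' o : Operation} (h : σ.Precedes o' o)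
    (ho : o ∈ σ.operations) : o' ∈ σ.operations := by
  rw [Route.mem_operations] at ho ⊢
  cases o' <;> cases o <;> simp only [Route.Precedes] at h <;> simp only at ho ⊢ <;> omega

/-- An acyclic walk has at most `card V` hops: the paths to the pair contribute at most `card V +
1`, processing one more, and the output fewer than `card V`. -/
theorem Route.crossed_lt_of_mem [Fintype V] {σ : Route V} (h1 : σ.live.Nodup) (h2 : σ.stat.Nodup)
    (h3 : σ.output.Nodup) {o : Operation} (ho : o ∈ σ.operations) :
    σ.crossed o < 2 * Fintype.card V + 3 := by
  rw [Route.mem_operations] at ho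
  have l1 := (hops_length_le σ.live).trans h1.length_le_card
  have l2 := (hops_length_le σ.stat).trans h2.length_le_card
  have l3 := (hops_length_le σ.output).trans h3.length_le_card
  cases o <;> simp only at ho <;> simp only [Route.crossed] <;> omega

theorem EdgeNetwork.size_pos (N : EdgeNetwork V K Φ ι) (c : ι) (o : Operation) :
    0 < N.size c o := by
  cases o
  · exact one_pos
  · exact N.merging_pos _
  · exact N.workload_pos _
  · exact N.scaling_pos _

/-- The resources of the network, as a finite set. -/
noncomputable def EdgeNetwork.resources [Fintype V] (N : EdgeNetwork V K Φ ι) :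
    Finset (Resource V) :=
  N.links.image Resource.link ∪ Finset.univ.image Resource.node

theorem EdgeNetwork.mem_resources [Fintype V] (N : EdgeNetwork V K Φ ι) {r : Resource V} :
    r ∈ N.resources ↔ N.HasResource r := by
  cases r <;> simp [EdgeNetwork.resources, EdgeNetwork.HasResource]

theorem EdgeNetwork.sum_resources [Fintype V] (N : EdgeNetwork V K Φ ι) (g : Resource V → ℝ) :
    ∑ r ∈ N.resources, g r = ∑ e ∈ N.links, g (.link e) + ∑ i, g (.node i) := by
  unfold EdgeNetwork.resources
  rw [Finset.sum_union, Finset.sum_image, Finset.sum_image]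
  · intro x _ y _ h; simpa using h
  · intro x _ y _ h; simpa using h
  · rw [Finset.disjoint_right]; simp

theorem EdgeNetwork.cap_pos (N : EdgeNetwork V K Φ ι) {r : Resource V} (h : N.HasResource r) :
    0 < N.cap r := by
  cases r
  · exact N.nodeCap_pos _
  · exact N.linkCap_pos _ h

theorem EdgeNetwork.IsRoute.hasResource {N : EdgeNetwork V K Φ ι} {c : ι} {σ : Route V}
    (h : N.IsRoute c σ) {o : Operation} {r : Resource V} (hr : σ.site o = some r) :
    N.HasResource r := by
  cases o <;> simp only [Route.site, Option.map_eq_some_iff, Option.some.injEq] at hr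
  · obtain ⟨e, he, rfl⟩ := hr
    exact h.live_chain.of_mem_hops e (List.mem_of_getElem? he)
  · obtain ⟨e, he, rfl⟩ := hr
    exact h.stat_chain.of_mem_hops e (List.mem_of_getElem? he)
  · subst hr; trivial
  · obtain ⟨e, he, rfl⟩ := hr
    exact h.output_chain.of_mem_hops e (List.mem_of_getElem? he)

theorem Route.exists_site {σ : Route V} {o : Operation} (ho : o ∈ σ.operations) :
    ∃ r, σ.site o = some r := by
  rw [Route.mem_operations] at ho
  cases o <;> simp only at ho <;> simp [Route.site, ho]

/-- The work that a request of client `c` on route `σ` brings to a resource. -/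
noncomputable def EdgeNetwork.opLoad (N : EdgeNetwork V K Φ ι) (c : ι) (σ : Route V)
    (r : Resource V) : ℝ :=
  ∑ o ∈ σ.operations, if σ.site o = some r then N.size c o else 0

/-- `load` has indicators of links where `opLoad` counts hops with multiplicity. The indicator never
exceeds the count, even if `p` refers to a shortened walk; the next lemma is the converse for walks
that repeat no hop. -/
theorem le_sum_getElem? {β : Type*} [DecidableEq β] {l : List β} {e : β} {x : ℝ}
    (hx : 0 ≤ x) {p : Prop}
    [Decidable p] (h : p → e ∈ l) :
    x * (if p then 1 else 0) ≤ ∑ k ∈ Finset.range l.length, if l[k]? = some e then x else 0 := by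
  split_ifs with hp
  · obtain ⟨k, hk, hke⟩ := List.getElem_of_mem (h hp)
    have := Finset.single_le_sum (s := Finset.range l.length)
      (f := fun k => if l[k]? = some e then x else 0) (fun k _ => by positivity)
      (Finset.mem_range.2 hk)
    simpa [hk, hke] using this
  · simp only [mul_zero]; positivity

theorem sum_getElem?_le {β : Type*} [DecidableEq β] {l : List β} (hl : l.Nodup) (e : β) (x : ℝ)
    [Decidable (e ∈ l)] :
    (∑ k ∈ Finset.range l.length, if l[k]? = some e then x else 0)
      ≤ x * (if e ∈ l then 1 else 0) := by
  split_ifs with h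
  · obtain ⟨k, hk, hke⟩ := List.getElem_of_mem h
    rw [Finset.sum_eq_single k]
    · simp [hk, hke]
    · intro j hj hjk
      rw [if_neg]
      intro hje
      apply hjk
      have hj' := Finset.mem_range.1 hj
      rw [List.getElem?_eq_getElem hj', Option.some.injEq] at hje
      exact (hl.getElem_inj_iff).1 (hje.trans hke.symm)
    · simp [hk]
  · rw [Finset.sum_eq_zero]
    · simp
    · intro k _
      rw [if_neg]
      exact fun hk => h (List.mem_of_getElem? hk)

theorem EdgeNetwork.opLoad_node (N : EdgeNetwork V K Φ ι) (c : ι) (σ : Route V) (i : V) :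
    N.opLoad c σ (.node i) = N.load c σ (.node i) := by
  simp [EdgeNetwork.opLoad, Route.sum_operations, Route.site, EdgeNetwork.load, EdgeNetwork.size]

theorem EdgeNetwork.opLoad_link (N : EdgeNetwork V K Φ ι) (c : ι) (σ : Route V) (e : V × V) :
    N.opLoad c σ (.link e) =
      (∑ k ∈ Finset.range (hops σ.live).length, if (hops σ.live)[k]? = some e then (1 : ℝ) else 0)
      + (∑ k ∈ Finset.range (hops σ.stat).length,
          if (hops σ.stat)[k]? = some e then N.merging (N.service c) else 0)
      + (∑ k ∈ Finset.range (hops σ.output).length,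
          if (hops σ.output)[k]? = some e then N.scaling (N.service c) else 0) := by
  simp [EdgeNetwork.opLoad, Route.sum_operations, Route.site, EdgeNetwork.size,
    Option.map_eq_some_iff]

theorem EdgeNetwork.IsStar.opLoad_le {N : EdgeNetwork V K Φ ι} {c : ι} {σ : Route V}
    (h : N.IsStar c σ) (r : Resource V) : N.opLoad c σ r ≤ N.load c σ r := by
  cases r with
  | node i => rw [N.opLoad_node]
  | link e =>
    rw [N.opLoad_link, EdgeNetwork.load]
    have h1 := sum_getElem?_le h.live_nodup.hops e 1
    have h2 := sum_getElem?_le h.stat_nodup.hops e (N.merging (N.service c))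
    have h3 := sum_getElem?_le h.output_nodup.hops e (N.scaling (N.service c))
    rw [one_mul] at h1
    exact add_le_add (add_le_add h1 h2) h3

/-- Every route can be shortened to an efficient one that loads no resource more. -/
theorem EdgeNetwork.IsRoute.exists_isStar {N : EdgeNetwork V K Φ ι} {c : ι} {σ : Route V}
    (h : N.IsRoute c σ) :
    ∃ τ, N.IsStar c τ ∧ ∀ r, N.load c τ r ≤ N.opLoad c σ r := by
  obtain ⟨l, l1, l2, l3, l4, -, l6⟩ := exists_nodup_walk _ σ.live le_rfl h.live_chain
  obtain ⟨s, s1, s2, s3, s4, -, s6⟩ := exists_nodup_walk _ σ.stat le_rfl h.stat_chain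
  obtain ⟨o, o1, o2, o3, o4, -, o6⟩ := exists_nodup_walk _ σ.output le_rfl h.output_chain
  refine ⟨⟨l, s, o, σ.proc⟩, ⟨⟨l2, l3.trans h.live_head, l4.trans h.live_last, s2, ?_,
    s4.trans h.stat_last, o2, o3.trans h.output_head, o4.trans h.output_last⟩, l1, s1, o1⟩, ?_⟩
  · obtain ⟨v, hv, hv'⟩ := h.stat_head
    exact ⟨v, hv, s3.trans hv'⟩
  · intro r
    cases r with
    | node i => rw [N.opLoad_node]; rfl
    | link e =>
      rw [N.opLoad_link, EdgeNetwork.load]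
      refine add_le_add (add_le_add ?_ ?_) ?_
      · rw [← one_mul (ite _ _ _)]
        exact le_sum_getElem? zero_le_one (fun h => l6 h)
      · exact le_sum_getElem? (N.merging_pos _).le (fun h => s6 h)
      · exact le_sum_getElem? (N.scaling_pos _).le (fun h => o6 h)

theorem EdgeNetwork.load_nonneg (N : EdgeNetwork V K Φ ι) (c : ι) (σ : Route V)
    (r : Resource V) : 0 ≤ N.load c σ r := by
  have h1 := N.merging_pos (N.service c)
  have h2 := N.scaling_pos (N.service c)
  have h3 := N.workload_pos (N.service c)
  cases r <;> simp only [EdgeNetwork.load] <;> positivity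

theorem EdgeNetwork.exists_load_le [Fintype ι] (N : EdgeNetwork V K Φ ι) :
    ∃ B : ℝ, 0 ≤ B ∧ ∀ c σ r, N.load c σ r ≤ B := by
  have hpos : ∀ c, 0 ≤ 1 + N.merging (N.service c) + N.scaling (N.service c)
      + N.workload (N.service c) := fun c => by
    have h1 := N.merging_pos (N.service c)
    have h2 := N.scaling_pos (N.service c)
    have h3 := N.workload_pos (N.service c)
    positivity
  refine ⟨∑ c, (1 + N.merging (N.service c) + N.scaling (N.service c)
      + N.workload (N.service c)), Finset.sum_nonneg fun c _ => hpos c, fun c σ r => ?_⟩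
  refine le_trans ?_ (Finset.single_le_sum (fun c _ => hpos c) (Finset.mem_univ c))
  have h1 := N.merging_pos (N.service c)
  have h2 := N.scaling_pos (N.service c)
  have h3 := N.workload_pos (N.service c)
  cases r <;> simp only [EdgeNetwork.load] <;> split_ifs <;> linarith

theorem EdgeNetwork.exists_le_size [Fintype ι] (N : EdgeNetwork V K Φ ι) :
    ∃ b : ℝ, 0 < b ∧ ∀ c o, b ≤ N.size c o := by
  have hpos : ∀ c, 0 ≤ 1 + (N.merging (N.service c))⁻¹ + (N.scaling (N.service c))⁻¹
      + (N.workload (N.service c))⁻¹ := fun c => by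
    have h1 := N.merging_pos (N.service c)
    have h2 := N.scaling_pos (N.service c)
    have h3 := N.workload_pos (N.service c)
    positivity
  set S := ∑ c, (1 + (N.merging (N.service c))⁻¹ + (N.scaling (N.service c))⁻¹
      + (N.workload (N.service c))⁻¹) with hS
  have hS0 : 0 ≤ S := Finset.sum_nonneg fun c _ => hpos c
  -- The inverse of each size is at most `S + 1`; the added one serves the live packets and keeps
  -- the bound positive when there are no clients.
  refine ⟨(S + 1)⁻¹, by positivity, fun c o => ?_⟩
  apply inv_le_of_inv_le₀ (N.size_pos c o)
  have h := Finset.single_le_sum (fun c _ => hpos c) (Finset.mem_univ c)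
  rw [← hS] at h
  have h1 := inv_pos.2 (N.merging_pos (N.service c))
  have h2 := inv_pos.2 (N.scaling_pos (N.service c))
  have h3 := inv_pos.2 (N.workload_pos (N.service c))
  cases o <;> simp only [EdgeNetwork.size]
  · simp; linarith
  all_goals linarith

end Routes

/-! ### Arrived requests, feasible controls and the dual capacity condition -/

section Arrivals

open Classical

variable {V K Φ ι : Type*}

/-- The pairs of a request in `A` and one of its operations. -/
noncomputable def Control.pairs (u : Control V ι) (A : Finset (Request ι)) :
    Finset (Request ι × Operation) :=
  A.biUnion fun q => (u.route q).operations.image fun o => (q, o)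

theorem Control.mem_pairs {u : Control V ι} {A : Finset (Request ι)}
    {x : Request ι × Operation} :
    x ∈ u.pairs A ↔ x.1 ∈ A ∧ x.2 ∈ (u.route x.1).operations := by
  rcases x with ⟨q, o⟩
  simp only [Control.pairs, Finset.mem_biUnion, Finset.mem_image, Prod.mk.injEq]
  constructor
  · rintro ⟨q', hq, o', ho, rfl, rfl⟩
    exact ⟨hq, ho⟩
  · rintro ⟨hq, ho⟩
    exact ⟨q, hq, o, ho, rfl, rfl⟩

theorem Control.sum_pairs (u : Control V ι) (A : Finset (Request ι))
    (g : Request ι × Operation → ℝ) :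
    ∑ x ∈ u.pairs A, g x = ∑ q ∈ A, ∑ o ∈ (u.route q).operations, g (q, o) := by
  unfold Control.pairs
  rw [Finset.sum_biUnion]
  · refine Finset.sum_congr rfl fun q _ => ?_
    rw [Finset.sum_image]
    intro x _ y _ h
    simpa using h
  · intro q _ q' _ hqq
    rw [Function.onFun, Finset.disjoint_left]
    intro x hx hx'
    simp only [Finset.mem_image] at hx hx'
    obtain ⟨n, _, rfl⟩ := hx
    obtain ⟨n', _, h⟩ := hx'
    simp only [Prod.mk.injEq] at h
    exact hqq h.1.symm

variable [Fintype ι]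

/-! ## Sums over the requests that have arrived -/

/-- The requests that arrive in the slots before `t`. -/
noncomputable def arrivedBefore (α : ℕ → ι → ℕ) (t : ℕ) : Finset (Request ι) :=
  (Finset.range t ×ˢ Finset.univ).biUnion fun p =>
    (Finset.range (α p.1 p.2)).image fun n => ⟨p.1, p.2, n⟩

theorem arrived_eq_arrivedBefore (α : ℕ → ι → ℕ) (t : ℕ) :
    arrived α t = arrivedBefore α (t + 1) := rfl

theorem mem_arrivedBefore {α : ℕ → ι → ℕ} {t : ℕ} {q : Request ι} :
    q ∈ arrivedBefore α t ↔ q.slot < t ∧ q.index < α q.slot q.client := by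
  rcases q with ⟨s, c, n⟩
  simp only [arrivedBefore, Finset.mem_biUnion, Finset.mem_product, Finset.mem_range,
    Finset.mem_univ, and_true, Finset.mem_image, Request.mk.injEq, Prod.exists]
  constructor
  · rintro ⟨s', c', hs, n', hn, rfl, rfl, rfl⟩
    exact ⟨hs, hn⟩
  · rintro ⟨hs, hn⟩
    exact ⟨s, c, hs, n, hn, rfl, rfl, rfl⟩

theorem mem_arrived {α : ℕ → ι → ℕ} {t : ℕ} {q : Request ι} :
    q ∈ arrived α t ↔ q.slot ≤ t ∧ q.index < α q.slot q.client := by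
  rw [arrived_eq_arrivedBefore, mem_arrivedBefore, Nat.lt_succ_iff]

theorem sum_arrivedBefore (α : ℕ → ι → ℕ) (t : ℕ) (f : Request ι → ℝ) :
    ∑ q ∈ arrivedBefore α t, f q =
      ∑ s ∈ Finset.range t, ∑ c, ∑ n ∈ Finset.range (α s c), f ⟨s, c, n⟩ := by
  unfold arrivedBefore
  rw [Finset.sum_biUnion, Finset.sum_product]
  · refine Finset.sum_congr rfl fun s _ => Finset.sum_congr rfl fun c _ => ?_
    rw [Finset.sum_image]
    intro x _ y _ h
    simpa using h
  · intro p _ p' _ hpp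
    rw [Function.onFun, Finset.disjoint_left]
    intro q hq hq'
    simp only [Finset.mem_image] at hq hq'
    obtain ⟨n, _, rfl⟩ := hq
    obtain ⟨n', _, h⟩ := hq'
    simp only [Request.mk.injEq] at h
    exact hpp (Prod.ext h.1.symm h.2.1.symm)

theorem sum_arrivedBefore_succ (α : ℕ → ι → ℕ) (t : ℕ) (f : Request ι → ℝ) :
    ∑ q ∈ arrivedBefore α (t + 1), f q = ∑ q ∈ arrivedBefore α t, f q
      + ∑ c, ∑ n ∈ Finset.range (α t c), f ⟨t, c, n⟩ := by
  rw [sum_arrivedBefore, sum_arrivedBefore, Finset.sum_range_succ]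

variable {N : EdgeNetwork V K Φ ι} {α : ℕ → ι → ℕ} {u : Control V ι}

theorem EdgeNetwork.mem_queue {t : ℕ} {e : Resource V} {x : Request ι × Operation} :
    x ∈ N.queue α u t e ↔ x.1 ∈ arrived α t ∧ x.2 ∈ (u.route x.1).operations ∧
      (u.route x.1).site x.2 = some e ∧ N.Ready u t x ∧ ¬ N.Done u t x := by
  have : N.queue α u t e = (u.pairs (arrived α t)).filter
    fun x => (u.route x.1).site x.2 = some e ∧ N.Ready u t x ∧ ¬ N.Done u t x := rfl
  rw [this, Finset.mem_filter, Control.mem_pairs, and_assoc]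

/-! ## Feasible controls -/

namespace EdgeNetwork.Feasible

theorem work_mono (h : N.Feasible α u) {s t : ℕ} (hst : s ≤ t) (x : Request ι × Operation) :
    u.work s x ≤ u.work t x :=
  Finset.sum_le_sum_of_subset_of_nonneg (by simpa using hst) fun _ _ _ => h.nonneg _ _

theorem done_mono (h : N.Feasible α u) {s t : ℕ} (hst : s ≤ t) {x : Request ι × Operation}
    (hx : N.Done u s x) : N.Done u t x :=
  le_trans hx (h.work_mono hst x)

theorem ready_mono (h : N.Feasible α u) {s t : ℕ} (hst : s ≤ t) {x : Request ι × Operation}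
    (hx : N.Ready u s x) : N.Ready u t x :=
  fun o ho => h.done_mono hst (hx o ho)

theorem arrived_mono {s t : ℕ} (hst : s ≤ t) : arrived α s ⊆ arrived α t := fun q hq => by
  rw [mem_arrived] at hq ⊢
  exact ⟨hq.1.trans hst, hq.2⟩

theorem isRoute_of_mem (h : N.Feasible α u) {t : ℕ} {q : Request ι} (hq : q ∈ arrived α t) :
    N.IsRoute q.client (u.route q) :=
  h.isRoute q (mem_arrived.1 hq).2

/-- Resources serve the operations in their queues only. -/
theorem sum_serve_le (h : N.Feasible α u) (t : ℕ) {e : Resource V}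
    (S : Finset (Request ι × Operation)) (hS : ∀ x ∈ S, (u.route x.1).site x.2 = some e) :
    ∑ x ∈ S, u.serve t x ≤ ∑ x ∈ N.queue α u t e, u.serve t x := by
  rw [← Finset.sum_filter_ne_zero]
  refine Finset.sum_le_sum_of_subset_of_nonneg (fun x hx => ?_) fun _ _ _ => h.nonneg _ _
  obtain ⟨hx, hne⟩ := Finset.mem_filter.1 hx
  obtain ⟨e', he'⟩ := h.queued t x hne
  have h1 := (mem_queue.1 he').2.2.1
  rw [hS x hx, Option.some.injEq] at h1
  exact h1 ▸ he'

theorem sum_work_le (h : N.Feasible α u) (t : ℕ) {e : Resource V} (he : N.HasResource e)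
    (S : Finset (Request ι × Operation)) (hS : ∀ x ∈ S, (u.route x.1).site x.2 = some e) :
    ∑ x ∈ S, u.work t x ≤ t * N.cap e := by
  unfold Control.work
  rw [Finset.sum_comm]
  calc ∑ s ∈ Finset.range t, ∑ x ∈ S, u.serve s x
      ≤ ∑ s ∈ Finset.range t, N.cap e :=
        Finset.sum_le_sum fun s _ => (h.sum_serve_le s S hS).trans (h.capacity s e he)
    _ = t * N.cap e := by simp

/-- A request with an unfinished operation that has crossed less than `k` edges has one which
waits in a queue. -/
theorem exists_mem_queue (h : N.Feasible α u) {t : ℕ} {q : Request ι}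
    (hq : q ∈ arrived α t) : ∀ (n : ℕ) {o : Operation}, (u.route q).crossed o ≤ n →
    o ∈ (u.route q).operations → ¬ N.Done u t (q, o) →
    ∃ o' e, N.HasResource e ∧ (q, o') ∈ N.queue α u t e := by
  intro n
  induction n using Nat.strong_induction_on with
  | _ n ih =>
    intro o hn ho hd
    by_cases hr : N.Ready u t (q, o)
    · obtain ⟨e, he⟩ := Route.exists_site ho
      exact ⟨o, e, (h.isRoute_of_mem hq).hasResource he, mem_queue.2 ⟨hq, ho, he, hr, hd⟩⟩
    -- An unfinished predecessor has a smaller count, so the descent ends at an operation that is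
    -- ready.
    · simp only [EdgeNetwork.Ready, not_forall] at hr
      obtain ⟨o', hp, hd'⟩ := hr
      exact ih _ (hp.crossed_lt.trans_le hn) le_rfl (hp.mem_operations ho) hd'

end EdgeNetwork.Feasible

/-- The requests that have arrived but are not delivered. -/
noncomputable def EdgeNetwork.undelivered (N : EdgeNetwork V K Φ ι) (α : ℕ → ι → ℕ)
    (u : Control V ι) (t : ℕ) : Finset (Request ι) :=
  (arrived α t).filter fun q => ∃ o ∈ (u.route q).operations, ¬ N.Done u t (q, o)

theorem EdgeNetwork.Feasible.card_undelivered_le [Fintype V] (h : N.Feasible α u) (t : ℕ) :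
    (N.undelivered α u t).card ≤ ∑ e ∈ N.resources, (N.queue α u t e).card := by
  calc (N.undelivered α u t).card
      ≤ (N.resources.biUnion fun e => (N.queue α u t e).image Prod.fst).card := by
        refine Finset.card_le_card fun q hq => ?_
        obtain ⟨hq, o, ho, hd⟩ := Finset.mem_filter.1 hq
        obtain ⟨o', e, he, hx⟩ := h.exists_mem_queue hq _ le_rfl ho hd
        exact Finset.mem_biUnion.2 ⟨e, N.mem_resources.2 he, Finset.mem_image_of_mem Prod.fst hx⟩
    _ ≤ ∑ e ∈ N.resources, ((N.queue α u t e).image Prod.fst).card := Finset.card_biUnion_le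
    _ ≤ _ := Finset.sum_le_sum fun e _ => Finset.card_image_le

theorem EdgeNetwork.RateStable.tendsto_undelivered [Fintype V] (hs : N.RateStable α u)
    (h : N.Feasible α u) :
    Tendsto (fun t : ℕ => ((N.undelivered α u t).card : ℝ) / t) atTop (𝓝 0) := by
  have h1 : Tendsto (fun t : ℕ => ∑ e ∈ N.resources, ((N.queue α u t e).card : ℝ) / t) atTop
      (𝓝 (∑ e ∈ N.resources, 0)) := by
    refine tendsto_finsetSum _ fun e he => ?_
    rw [N.mem_resources] at he
    cases e with
    | node i => exact hs.processing i
    | link e => exact hs.transmission e he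
  rw [Finset.sum_const_zero] at h1
  refine squeeze_zero (fun t => by positivity) (fun t => ?_) h1
  rw [← Finset.sum_div]
  gcongr
  exact_mod_cast h.card_undelivered_le t

/-! ## A necessary condition for stability -/

/-- In slot `T` the requests of `T + 1` slots have arrived but only `T` slots of work have been
done; the limit ignores the difference. -/
theorem tendsto_sum_range_succ_div {f : ℕ → ℝ} {l : ℝ}
    (h : Tendsto (fun T : ℕ => (∑ t ∈ Finset.range T, f t) / T) atTop (𝓝 l)) :
    Tendsto (fun T : ℕ => (∑ t ∈ Finset.range (T + 1), f t) / T) atTop (𝓝 l) := by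
  have h1 := h.comp (tendsto_add_atTop_nat 1)
  have h2 : Tendsto (fun T : ℕ => 1 + 1 / (T : ℝ)) atTop (𝓝 (1 + 0)) :=
    tendsto_const_nhds.add tendsto_one_div_atTop_nhds_zero_nat
  have h3 := h1.mul h2
  rw [add_zero, mul_one] at h3
  refine h3.congr' ?_
  filter_upwards [eventually_gt_atTop 0] with T hT
  have : (T : ℝ) ≠ 0 := by positivity
  have : (T : ℝ) + 1 ≠ 0 := by positivity
  simp only [Function.comp, Nat.cast_add, Nat.cast_one]
  field_simp

/-- If the arrivals can be handled by a rate stable control, then no prices of the resources make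
the cheapest routes of the arrivals cost more than all the capacity. -/
theorem EdgeNetwork.RateStable.sum_price_le [Fintype V] (hs : N.RateStable α u)
    (h : N.Feasible α u) {lam : ι → ℝ}
    (hα : ∀ c, Tendsto (fun T : ℕ => (∑ t ∈ Finset.range T, (α t c : ℝ)) / T) atTop (𝓝 (lam c)))
    {w : Resource V → ℝ} (hw : ∀ r ∈ N.resources, 0 ≤ w r) {m : ι → ℝ}
    (hm : ∀ c τ, N.IsStar c τ → m c ≤ ∑ r ∈ N.resources, w r * N.load c τ r) :
    ∑ c, lam c * m c ≤ ∑ r ∈ N.resources, w r * N.cap r := by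
  obtain ⟨M, hM⟩ : ∃ M : ℝ, ∀ c, m c ≤ M := by
    obtain ⟨M, hM⟩ := (Set.finite_range m).bddAbove
    exact ⟨M, fun c => hM ⟨c, rfl⟩⟩
  have key : ∀ T : ℕ, ∑ c, (∑ t ∈ Finset.range (T + 1), (α t c : ℝ)) * m c
      ≤ T * ∑ r ∈ N.resources, w r * N.cap r + (N.undelivered α u T).card * M := by
    intro T
    -- The delivered requests: these pay for their routes in work already spent, while each
    -- undelivered one is charged at most `M`.
    set D := (arrived α T).filter fun q => ¬ ∃ o ∈ (u.route q).operations, ¬ N.Done u T (q, o)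
      with hD
    have e1 : ∑ c, (∑ t ∈ Finset.range (T + 1), (α t c : ℝ)) * m c
        = ∑ q ∈ arrived α T, m q.client := by
      rw [arrived_eq_arrivedBefore, sum_arrivedBefore, Finset.sum_comm]
      simp [Finset.sum_mul]
    have e2 : ∑ q ∈ arrived α T, m q.client
        = ∑ q ∈ N.undelivered α u T, m q.client + ∑ q ∈ D, m q.client :=
      (Finset.sum_filter_add_sum_filter_not _ _ _).symm
    have e3 : ∑ q ∈ N.undelivered α u T, m q.client ≤ (N.undelivered α u T).card * M := by
      rw [← nsmul_eq_mul]
      exact Finset.sum_le_card_nsmul _ _ _ fun q _ => hM _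
    have e4 : ∑ q ∈ D, m q.client
        ≤ ∑ q ∈ D, ∑ r ∈ N.resources, w r * N.opLoad q.client (u.route q) r := by
      refine Finset.sum_le_sum fun q hq => ?_
      obtain ⟨τ, hτ, hle⟩ := (h.isRoute_of_mem (Finset.mem_filter.1 hq).1).exists_isStar
      exact (hm _ τ hτ).trans (Finset.sum_le_sum fun r hr =>
        mul_le_mul_of_nonneg_left (hle r) (hw r hr))
    have e5 : ∀ r ∈ N.resources, ∑ q ∈ D, N.opLoad q.client (u.route q) r ≤ T * N.cap r := by
      intro r hr
      have : ∑ q ∈ D, N.opLoad q.client (u.route q) r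
          = ∑ x ∈ (u.pairs D).filter (fun x => (u.route x.1).site x.2 = some r),
            N.size x.1.client x.2 := by
        rw [Finset.sum_filter (s := u.pairs D), Control.sum_pairs]
        rfl
      rw [this]
      -- For a finished operation the size is at most the work spent on it.
      refine le_trans (Finset.sum_le_sum fun x hx => ?_)
        (h.sum_work_le T (N.mem_resources.1 hr) _ fun x hx => (Finset.mem_filter.1 hx).2)
      have hx1 := Control.mem_pairs.1 (Finset.mem_filter.1 hx).1
      have hx2 := (Finset.mem_filter.1 hx1.1).2
      push Not at hx2
      exact hx2 x.2 hx1.2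
    rw [e1, e2, add_comm]
    refine add_le_add (e4.trans ?_) e3
    rw [Finset.sum_comm, Finset.mul_sum]
    refine Finset.sum_le_sum fun r hr => ?_
    rw [← Finset.mul_sum]
    calc w r * ∑ q ∈ D, N.opLoad q.client (u.route q) r ≤ w r * (T * N.cap r) :=
          mul_le_mul_of_nonneg_left (e5 r hr) (hw r hr)
      _ = _ := by ring
  have l1 : Tendsto (fun T : ℕ => ∑ c, (∑ t ∈ Finset.range (T + 1), (α t c : ℝ)) / T * m c) atTop
      (𝓝 (∑ c, lam c * m c)) :=
    tendsto_finsetSum _ fun c _ => (tendsto_sum_range_succ_div (hα c)).mul_const _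
  have l2 : Tendsto (fun T : ℕ => ∑ r ∈ N.resources, w r * N.cap r
      + ((N.undelivered α u T).card : ℝ) / T * M) atTop
      (𝓝 (∑ r ∈ N.resources, w r * N.cap r + 0 * M)) :=
    tendsto_const_nhds.add ((hs.tendsto_undelivered h).mul_const _)
  rw [zero_mul, add_zero] at l2
  refine le_of_tendsto_of_tendsto l1 l2 ?_
  filter_upwards [eventually_gt_atTop 0] with T hT
  have hT' : (0 : ℝ) < T := by exact_mod_cast hT
  have := div_le_div_of_nonneg_right (key T) hT'.le
  rw [Finset.sum_div] at this
  refine le_trans (le_of_eq (Finset.sum_congr rfl fun c _ => by ring)) (this.trans (le_of_eq ?_))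
  field_simp

end Arrivals

section Drift

/-! ## Rate stability of the virtual queues -/

/-- Summation by parts: it trades `g` for its partial sums, which will be o(T), and `m` for its
increments, which will be bounded. -/
theorem sum_range_mul_eq (g m : ℕ → ℝ) (T : ℕ) :
    ∑ t ∈ Finset.range T, g t * m t = (∑ t ∈ Finset.range T, g t) * m T
      - ∑ t ∈ Finset.range T, (∑ s ∈ Finset.range (t + 1), g s) * (m (t + 1) - m t) := by
  induction T with
  | zero => simp
  | succ T ih =>
    rw [Finset.sum_range_succ, ih, Finset.sum_range_succ
      (fun t => (∑ s ∈ Finset.range (t + 1), g s) * (m (t + 1) - m t)) T, Finset.sum_range_succ g T]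
    ring

/-- If the averages of `g` tend to zero and `m` is Lipschitz, then `∑ g m` is of smaller than
quadratic order. -/
theorem tendsto_sum_mul_div_sq {g m : ℕ → ℝ} {L : ℝ}
    (hg : Tendsto (fun T : ℕ => (∑ t ∈ Finset.range T, g t) / T) atTop (𝓝 0))
    (hm0 : m 0 = 0) (hm : ∀ t, |m (t + 1) - m t| ≤ L) :
    Tendsto (fun T : ℕ => (∑ t ∈ Finset.range T, g t * m t) / (T : ℝ) ^ 2) atTop (𝓝 0) := by
  have hL : 0 ≤ L := (abs_nonneg _).trans (hm 0)
  have hmT : ∀ T, |m T| ≤ T * L := by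
    intro T
    induction T with
    | zero => simp [hm0]
    | succ T ih =>
      have := abs_add_le (m T) (m (T + 1) - m T)
      rw [add_sub_cancel] at this
      push_cast
      linarith [hm T]
  set S : ℕ → ℝ := fun T => ∑ t ∈ Finset.range T, g t with hS
  have h1 : Tendsto (fun T : ℕ => |S T / T| * L) atTop (𝓝 0) := by
    simpa using (hg.abs).mul_const L
  -- Cesàro averages of a null sequence are null; the index `t + 1` matches the partial sums and
  -- avoids division by zero.
  have h2 : Tendsto (fun T : ℕ => (T : ℝ)⁻¹ * ∑ t ∈ Finset.range T, |S (t + 1) / (t + 1 : ℕ)|) atTop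
      (𝓝 0) := by
    refine Filter.Tendsto.cesaro (u := fun t : ℕ => |S (t + 1) / (t + 1 : ℕ)|) ?_
    have := (hg.comp (tendsto_add_atTop_nat 1)).abs
    simpa using this
  have h3 := h1.add (h2.mul_const L)
  simp only [zero_mul, add_zero] at h3
  refine squeeze_zero_norm' ?_ h3
  filter_upwards [eventually_gt_atTop 0] with T hT
  have hT' : (0 : ℝ) < T := by exact_mod_cast hT
  rw [Real.norm_eq_abs, abs_div, abs_of_pos (pow_pos hT' 2), div_le_iff₀ (pow_pos hT' 2),
    sum_range_mul_eq]
  refine (abs_sub _ _).trans ?_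
  have b1 : |S T * m T| ≤ |S T / T| * L * T ^ 2 := by
    rw [abs_mul, abs_div, abs_of_pos hT']
    calc |S T| * |m T| ≤ |S T| * (T * L) := by gcongr; exact hmT T
      _ = _ := by field_simp
  have b2 : |∑ t ∈ Finset.range T, S (t + 1) * (m (t + 1) - m t)|
      ≤ (T : ℝ)⁻¹ * (∑ t ∈ Finset.range T, |S (t + 1) / (t + 1 : ℕ)|) * L * T ^ 2 := by
    have : (T : ℝ)⁻¹ * (∑ t ∈ Finset.range T, |S (t + 1) / (t + 1 : ℕ)|) * L * T ^ 2
        = ∑ t ∈ Finset.range T, |S (t + 1) / (t + 1 : ℕ)| * (T * L) := by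
      rw [← Finset.sum_mul]
      field_simp
    rw [this]
    refine (Finset.abs_sum_le_sum_abs _ _).trans (Finset.sum_le_sum fun t ht => ?_)
    have ht' : ((t + 1 : ℕ) : ℝ) ≤ T := by exact_mod_cast Finset.mem_range.1 ht
    have hp : (0 : ℝ) < ((t + 1 : ℕ) : ℝ) := by positivity
    rw [abs_mul, abs_div, abs_of_pos hp]
    calc |S (t + 1)| * |m (t + 1) - m t|
        ≤ |S (t + 1)| / ((t + 1 : ℕ) : ℝ) * (((t + 1 : ℕ) : ℝ) * L) := by
          rw [← mul_assoc, div_mul_cancel₀ _ hp.ne']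
          gcongr
          exact hm t
      _ ≤ _ := by gcongr
  calc _ ≤ _ := add_le_add b1 b2
    _ = _ := by ring

/-- Queues whose arrivals are routed by minimum weights are rate stable if the arrival rates
satisfy the capacity constraints in the dual form `hdual`. -/
theorem tendsto_queue_div {R ι : Type*} [Fintype ι] {s : Finset R} {cap : R → ℝ}
    (hcap : ∀ r ∈ s, 0 < cap r) {Q a : R → ℕ → ℝ} {B : ℝ} (ha0 : ∀ r t, 0 ≤ a r t)
    (haB : ∀ r t, a r t ≤ B) (hQ0 : ∀ r, Q r 0 = 0)
    (hQ : ∀ r t, Q r (t + 1) = max (Q r t - cap r + a r t) 0)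
    {α : ℕ → ι → ℕ} {lam : ι → ℝ}
    (hα : ∀ c, Tendsto (fun T : ℕ => (∑ t ∈ Finset.range T, (α t c : ℝ)) / T) atTop (𝓝 (lam c)))
    {m : ℕ → ι → ℝ} {L : ℝ} (hm0 : ∀ c, m 0 c = 0) (hm : ∀ t c, |m (t + 1) c - m t c| ≤ L)
    (hsum : ∀ t, ∑ r ∈ s, Q r t / cap r / cap r * a r t ≤ ∑ c, α t c * m t c)
    (hdual : ∀ t, ∑ c, lam c * m t c ≤ ∑ r ∈ s, Q r t / cap r / cap r * cap r) :
    ∀ r ∈ s, Tendsto (fun T : ℕ => Q r T / T) atTop (𝓝 0) := by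
  have hQnn : ∀ r t, 0 ≤ Q r t := by
    intro r t
    cases t with
    | zero => exact (hQ0 r).ge
    | succ t => rw [hQ]; exact le_max_right _ _
  -- Normalizing by `cap r` makes the drift weigh the arrivals by `Q / cap²`, exactly the weights
  -- used for routing.
  set W : ℕ → ℝ := fun t => ∑ r ∈ s, (Q r t / cap r) ^ 2 with hW
  set E : ℝ := ∑ r ∈ s, ((B + cap r) / cap r) ^ 2 with hE
  -- `hsum` bounds the arrival term by `∑ α * m`, and `hdual` bounds the service term below by `∑
  -- lam * m`; only the centred arrivals remain.
  have step : ∀ t, W (t + 1) ≤ W t + E + 2 * ∑ c, (α t c - lam c) * m t c := by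
    intro t
    have h1 : ∀ r ∈ s, (Q r (t + 1) / cap r) ^ 2 ≤ (Q r t / cap r) ^ 2
        + 2 * (Q r t / cap r / cap r * a r t - Q r t / cap r / cap r * cap r)
        + ((B + cap r) / cap r) ^ 2 := by
      intro r hr
      have hc := hcap r hr
      have h2 : (Q r (t + 1)) ^ 2 ≤ (Q r t - cap r + a r t) ^ 2 := by
        rw [hQ]
        rcases le_total (Q r t - cap r + a r t) 0 with h | h
        · rw [max_eq_right h, zero_pow two_ne_zero]; exact sq_nonneg _
        · rw [max_eq_left h]
      have h3 : (a r t - cap r) ^ 2 ≤ (B + cap r) ^ 2 := by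
        apply sq_le_sq'
        · linarith [ha0 r t, haB r t]
        · linarith [haB r t]
      have h4 : (Q r (t + 1)) ^ 2 ≤ (Q r t) ^ 2 + 2 * (Q r t * a r t - Q r t * cap r)
          + (B + cap r) ^ 2 := by nlinarith
      have h5 := div_le_div_of_nonneg_right h4 (sq_nonneg (cap r))
      rw [div_pow]
      refine h5.trans (le_of_eq ?_)
      field_simp
    have h6 := Finset.sum_le_sum h1
    rw [Finset.sum_add_distrib, Finset.sum_add_distrib, ← Finset.mul_sum,
      Finset.sum_sub_distrib] at h6
    have h7 : ∑ c, (α t c - lam c) * m t c = ∑ c, α t c * m t c - ∑ c, lam c * m t c := by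
      rw [← Finset.sum_sub_distrib]
      exact Finset.sum_congr rfl fun c _ => sub_mul _ _ _
    rw [h7]
    simp only [hW, hE]
    linarith [hsum t, hdual t]
  have bound : ∀ T : ℕ, W T ≤ T * E
      + 2 * ∑ c, ∑ t ∈ Finset.range T, (α t c - lam c) * m t c := by
    intro T
    induction T with
    | zero => simp [hW, hQ0]
    | succ T ih =>
      have := step T
      simp only [Finset.sum_range_succ, Finset.sum_add_distrib]
      push_cast
      linarith
  have lim : Tendsto (fun T : ℕ => 1 / (T : ℝ) * E
      + 2 * ∑ c, (∑ t ∈ Finset.range T, (α t c - lam c) * m t c) / (T : ℝ) ^ 2) atTop (𝓝 0) := by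
    have h1 : Tendsto (fun T : ℕ => 1 / (T : ℝ) * E) atTop (𝓝 (0 * E)) :=
      tendsto_one_div_atTop_nhds_zero_nat.mul_const E
    have h2 : Tendsto (fun T : ℕ => 2 * ∑ c, (∑ t ∈ Finset.range T, (α t c - lam c) * m t c)
        / (T : ℝ) ^ 2) atTop (𝓝 (2 * ∑ _c : ι, 0)) := by
      refine (tendsto_finsetSum _ fun c _ => ?_).const_mul 2
      refine tendsto_sum_mul_div_sq (m := fun t => m t c) ?_ (hm0 c) (fun t => hm t c)
      have h3 := (hα c).sub_const (lam c)
      rw [sub_self] at h3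
      refine h3.congr' ?_
      filter_upwards [eventually_gt_atTop 0] with T hT
      have hT' : (T : ℝ) ≠ 0 := by positivity
      rw [Finset.sum_sub_distrib]
      simp only [Finset.sum_const, Finset.card_range, nsmul_eq_mul]
      field_simp
    simpa using h1.add h2
  intro r hr
  have hc := hcap r hr
  have l1 : Tendsto (fun T : ℕ => (Q r T / cap r / T) ^ 2) atTop (𝓝 0) := by
    refine squeeze_zero' (Eventually.of_forall fun T => sq_nonneg _) ?_ lim
    filter_upwards [eventually_gt_atTop 0] with T hT
    have hT' : (0 : ℝ) < T := by exact_mod_cast hT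
    have h1 : (Q r T / cap r) ^ 2 ≤ W T :=
      Finset.single_le_sum (f := fun r => (Q r T / cap r) ^ 2) (fun r _ => sq_nonneg _) hr
    rw [div_pow, ← Finset.sum_div]
    refine (div_le_div_of_nonneg_right (h1.trans (bound T)) (sq_nonneg _)).trans (le_of_eq ?_)
    field_simp
  have l2 := (l1.sqrt).mul_const (cap r)
  rw [Real.sqrt_zero, zero_mul] at l2
  refine l2.congr fun T => ?_
  rw [Real.sqrt_sq (by have := hQnn r T; positivity)]
  field_simp

end Drift

/-! ### Sequences bounded above by sublinear growth -/

section Sublinear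

/-- Growth of less than linear order. -/
def Sublinear (f : ℕ → ℝ) : Prop := ∀ ε > 0, ∃ B, 0 ≤ B ∧ ∀ t : ℕ, f t ≤ ε * t + B

theorem Sublinear.of_tendsto {f : ℕ → ℝ} (h : Tendsto (fun t : ℕ => f t / t) atTop (𝓝 0)) :
    Sublinear f := by
  intro ε hε
  obtain ⟨T, hT⟩ := eventually_atTop.1 ((h.eventually (gt_mem_nhds hε)).and
    (eventually_gt_atTop 0))
  have hnn : 0 ≤ ∑ t ∈ Finset.range T, |f t| := Finset.sum_nonneg fun _ _ => abs_nonneg _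
  refine ⟨_, hnn, fun t => ?_⟩
  rcases lt_or_ge t T with ht | ht
  · have h1 := Finset.single_le_sum (f := fun t => |f t|) (fun _ _ => abs_nonneg _)
      (Finset.mem_range.2 ht)
    have h2 : 0 ≤ ε * t := by positivity
    have h3 := le_abs_self (f t)
    linarith
  · obtain ⟨h1, h2⟩ := hT t ht
    have h3 : (0 : ℝ) < t := by exact_mod_cast h2
    rw [div_lt_iff₀ h3] at h1
    linarith

theorem Sublinear.tendsto {f : ℕ → ℝ} (h : Sublinear f) (h0 : ∀ t, 0 ≤ f t) :
    Tendsto (fun t : ℕ => f t / t) atTop (𝓝 0) := by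
  rw [Metric.tendsto_atTop]
  intro ε hε
  obtain ⟨B, hB, hf⟩ := h (ε / 2) (half_pos hε)
  obtain ⟨T, hT⟩ := exists_nat_gt (2 * B / ε)
  refine ⟨T + 1, fun t ht => ?_⟩
  have h1 : (T : ℝ) + 1 ≤ t := by exact_mod_cast ht
  have h2 : (0 : ℝ) < t := by have : (0 : ℝ) ≤ T := by positivity
                              linarith
  rw [Real.dist_eq, sub_zero, abs_of_nonneg (div_nonneg (h0 t) h2.le), div_lt_iff₀ h2]
  rw [div_lt_iff₀ hε] at hT
  have h3 : (T : ℝ) * ε < t * ε := by gcongr; linarith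
  linarith [hf t]

theorem Sublinear.mono {f g : ℕ → ℝ} (hg : Sublinear g) (h : ∀ t, f t ≤ g t) : Sublinear f :=
  fun ε hε => by
    obtain ⟨B, hB, hg⟩ := hg ε hε
    exact ⟨B, hB, fun t => (h t).trans (hg t)⟩

theorem Sublinear.const (b : ℝ) : Sublinear fun _ => b :=
  fun ε hε => ⟨|b|, abs_nonneg b, fun t => by
    have : 0 ≤ ε * t := by positivity
    linarith [le_abs_self b]⟩

theorem Sublinear.add {f g : ℕ → ℝ} (hf : Sublinear f) (hg : Sublinear g) :
    Sublinear fun t => f t + g t := fun ε hε => by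
  obtain ⟨B, hB, hf⟩ := hf (ε / 2) (half_pos hε)
  obtain ⟨D, hD, hg⟩ := hg (ε / 2) (half_pos hε)
  exact ⟨B + D, add_nonneg hB hD, fun t => by linarith [hf t, hg t]⟩

theorem Sublinear.const_mul {f : ℕ → ℝ} (hf : Sublinear f) {b : ℝ} (hb : 0 ≤ b) :
    Sublinear fun t => b * f t := fun ε hε => by
  obtain ⟨B, hB, hf⟩ := hf (ε / (b + 1)) (by positivity)
  refine ⟨b * B, mul_nonneg hb hB, fun t => ?_⟩
  have h1 : b * (ε / (b + 1)) ≤ ε := by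
    rw [← mul_div_assoc, div_le_iff₀ (by positivity)]
    nlinarith
  calc b * f t ≤ b * (ε / (b + 1) * t + B) := mul_le_mul_of_nonneg_left (hf t) hb
    _ = b * (ε / (b + 1)) * t + b * B := by ring
    _ ≤ ε * t + b * B := by gcongr

theorem Sublinear.sum {R : Type*} (s : Finset R) {f : R → ℕ → ℝ}
    (hf : ∀ r ∈ s, Sublinear (f r)) : Sublinear fun t => ∑ r ∈ s, f r t := by
  classical
  induction s using Finset.induction_on with
  | empty => simpa using Sublinear.const 0
  | insert r s hr ih =>
    simp only [Finset.sum_insert hr]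
    exact (hf r (Finset.mem_insert_self _ _)).add
      (ih fun r' hr' => hf r' (Finset.mem_insert_of_mem hr'))

end Sublinear

section NearestToOrigin

open Classical

variable {V K Φ ι : Type*} [Fintype ι]

/-! ## Stability of the actual queues under extended nearest-to-origin scheduling -/

/-- The requests some packet of which has not yet crossed `k` edges. -/
noncomputable def EdgeNetwork.late (N : EdgeNetwork V K Φ ι) (α : ℕ → ι → ℕ)
    (u : Control V ι) (k t : ℕ) : Finset (Request ι) :=
  (arrived α t).filter fun q =>
    ∃ o ∈ (u.route q).operations, (u.route q).crossed o < k ∧ ¬ N.Done u t (q, o)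

/-- The packets in a queue that have crossed at most `k` edges. -/
noncomputable def EdgeNetwork.front (N : EdgeNetwork V K Φ ι) (α : ℕ → ι → ℕ)
    (u : Control V ι) (r : Resource V) (k t : ℕ) : Finset (Request ι × Operation) :=
  (N.queue α u t r).filter fun x => (u.route x.1).crossed x.2 ≤ k

/-- The work at resource `r` on packets with at most `k` crossed edges that remains in slot `t`
for the request `q`. -/
noncomputable def EdgeNetwork.remaining (N : EdgeNetwork V K Φ ι) (u : Control V ι)
    (r : Resource V) (k t : ℕ) (q : Request ι) : ℝ :=
  ∑ o ∈ (u.route q).operations, if (u.route q).site o = some r ∧ (u.route q).crossed o ≤ k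
    then N.size q.client o - u.work t (q, o) else 0

/-- The work that arrives at a resource in slot `t`. -/
noncomputable def EdgeNetwork.arrivingLoad (N : EdgeNetwork V K Φ ι) (α : ℕ → ι → ℕ)
    (u : Control V ι) (r : Resource V) (t : ℕ) : ℝ :=
  ∑ c, ∑ n ∈ Finset.range (α t c), N.load c (u.route ⟨t, c, n⟩) r

/-! ### Induction over the number of crossed edges -/

variable {N : EdgeNetwork V K Φ ι} {α : ℕ → ι → ℕ} {u : Control V ι}

theorem EdgeNetwork.arrivingLoad_nonneg (r : Resource V) (t : ℕ) :
    0 ≤ N.arrivingLoad α u r t :=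
  Finset.sum_nonneg fun _ _ => Finset.sum_nonneg fun _ _ => N.load_nonneg _ _ _

theorem EdgeNetwork.arrivingLoad_le {M : ℕ} (hM : ∀ t c, α t c ≤ M) {B : ℝ} (hB0 : 0 ≤ B)
    (hB : ∀ c σ r, N.load c σ r ≤ B) (r : Resource V) (t : ℕ) :
    N.arrivingLoad α u r t ≤ Fintype.card ι * (M * B) := by
  refine (Finset.sum_le_card_nsmul _ _ (M * B) fun c _ => ?_).trans (by simp)
  refine (Finset.sum_le_card_nsmul _ _ B fun n _ => hB _ _ _).trans ?_
  rw [Finset.card_range, nsmul_eq_mul]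
  have : (α t c : ℝ) ≤ M := by exact_mod_cast hM t c
  gcongr

/-- A request with an unfinished operation that is not late has that operation in the queue. -/
theorem EdgeNetwork.mem_front {r : Resource V} {k t : ℕ} {q : Request ι}
    (hq : q ∈ arrived α t) (hl : q ∉ N.late α u k t) {o : Operation}
    (ho : o ∈ (u.route q).operations) (hs : (u.route q).site o = some r)
    (hk : (u.route q).crossed o ≤ k) (hd : ¬ N.Done u t (q, o)) :
    (q, o) ∈ N.front α u r k t := by
  refine Finset.mem_filter.2 ⟨mem_queue.2 ⟨hq, ho, hs, ?_, hd⟩, hk⟩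
  intro o' ho'
  by_contra hd'
  exact hl (Finset.mem_filter.2 ⟨hq, o', ho'.mem_operations ho, ho'.crossed_lt.trans_le hk, hd'⟩)

namespace EdgeNetwork.Feasible

theorem work_nonneg (h : N.Feasible α u) (t : ℕ) (x : Request ι × Operation) : 0 ≤ u.work t x :=
  Finset.sum_nonneg fun _ _ => h.nonneg _ _

theorem remaining_le_opLoad (h : N.Feasible α u) (r : Resource V) (k t : ℕ) (q : Request ι) :
    N.remaining u r k t q ≤ N.opLoad q.client (u.route q) r := by
  refine Finset.sum_le_sum fun o _ => ?_
  have h1 := h.work_nonneg t (q, o)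
  have h2 := (N.size_pos q.client o).le
  split_ifs with h3 h4 h4
  · linarith
  · exact absurd h3.1 h4
  · exact h2
  · exact le_rfl

/-- If a packet of the front stays unfinished, the priority rule spends the whole capacity on counts
at most `k`, so the backlog evolves as a busy queue. Otherwise the whole front is finished within
the slot, and only late requests can still hold such work, at most `B` each. -/
theorem sum_remaining_succ_le (h : N.Feasible α u) (hE : N.ENTO α u)
    (hstar : ∀ q : Request ι, q.index < α q.slot q.client → N.IsStar q.client (u.route q))
    {B : ℝ} (hB : ∀ c σ r, N.load c σ r ≤ B) {r : Resource V} (hr : N.HasResource r) (k t : ℕ) :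
    ∑ q ∈ arrivedBefore α (t + 1), N.remaining u r k (t + 1) q ≤
      max (∑ q ∈ arrivedBefore α t, N.remaining u r k t q - N.cap r + N.arrivingLoad α u r t)
        ((N.late α u k t).card * B) := by
  by_cases hx : ∃ x ∈ N.front α u r k t, ¬ N.Done u (t + 1) x
  · refine le_max_of_le_left ?_
    obtain ⟨x, hx, hd⟩ := hx
    obtain ⟨hx, hxk⟩ := Finset.mem_filter.1 hx
    have hc := hE.priority t r hr x hx hd
    set S := (u.pairs (arrivedBefore α (t + 1))).filter fun x =>
      (u.route x.1).site x.2 = some r ∧ (u.route x.1).crossed x.2 ≤ k with hS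
    have h1 : N.cap r ≤ ∑ y ∈ S, u.serve t y := by
      rw [← hc]
      refine Finset.sum_le_sum_of_subset_of_nonneg (fun y hy => ?_) fun _ _ _ => h.nonneg _ _
      obtain ⟨hy, hyx⟩ := Finset.mem_filter.1 hy
      obtain ⟨y1, y2, y3, -⟩ := mem_queue.1 hy
      exact Finset.mem_filter.2 ⟨Control.mem_pairs.2 ⟨y1, y2⟩, y3, hyx.trans hxk⟩
    have h2 : ∑ q ∈ arrivedBefore α (t + 1), N.remaining u r k (t + 1) q
        = ∑ q ∈ arrivedBefore α (t + 1), N.remaining u r k t q - ∑ y ∈ S, u.serve t y := by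
      rw [hS, Finset.sum_filter (s := u.pairs _), Control.sum_pairs, ← Finset.sum_sub_distrib]
      refine Finset.sum_congr rfl fun q _ => ?_
      unfold EdgeNetwork.remaining
      rw [← Finset.sum_sub_distrib]
      refine Finset.sum_congr rfl fun o _ => ?_
      simp only [Control.work, Finset.sum_range_succ]
      split_ifs <;> ring
    have h3 : ∑ c, ∑ n ∈ Finset.range (α t c), N.remaining u r k t ⟨t, c, n⟩
        ≤ N.arrivingLoad α u r t :=
      Finset.sum_le_sum fun c _ => Finset.sum_le_sum fun n hn =>
        (h.remaining_le_opLoad r k t _).trans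
          ((hstar ⟨t, c, n⟩ (Finset.mem_range.1 hn)).opLoad_le r)
    rw [h2, sum_arrivedBefore_succ]
    linarith
  · refine le_max_of_le_right ?_
    push Not at hx
    have hsub : N.late α u k t ⊆ arrivedBefore α (t + 1) := Finset.filter_subset _ _
    have h1 : ∑ q ∈ arrivedBefore α (t + 1), N.remaining u r k (t + 1) q
        = ∑ q ∈ N.late α u k t, N.remaining u r k (t + 1) q := by
      refine (Finset.sum_subset hsub fun q hq hl => ?_).symm
      refine Finset.sum_eq_zero fun o ho => ?_
      split_ifs with hso
      · have hd : N.Done u (t + 1) (q, o) := by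
          by_contra hd
          exact hd (hx _ (mem_front hq hl ho hso.1 hso.2
            fun hd' => hd (h.done_mono t.le_succ hd')))
        exact le_antisymm (sub_nonpos.2 hd) (sub_nonneg.2 (h.work_le _ _))
      · rfl
    rw [h1, ← nsmul_eq_mul]
    refine Finset.sum_le_card_nsmul _ _ _ fun q hq => ?_
    have hq' := mem_arrived.1 (hsub hq)
    exact (h.remaining_le_opLoad r k _ q).trans (((hstar q hq'.2).opLoad_le r).trans (hB _ _ _))

/-- The backlog obeys the recursion of the virtual queue with the floor zero replaced by the load of
the late requests. As `ε * t + D` is nondecreasing, the excess over the virtual queue never outgrows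
the current floor. -/
theorem sum_remaining_le (h : N.Feasible α u) (hE : N.ENTO α u)
    (hstar : ∀ q : Request ι, q.index < α q.slot q.client → N.IsStar q.client (u.route q))
    {B : ℝ} (hB0 : 0 ≤ B) (hB : ∀ c σ r, N.load c σ r ≤ B) {r : Resource V}
    (hr : N.HasResource r) {k : ℕ} {ε D : ℝ} (hε : 0 ≤ ε) (hD : 0 ≤ D)
    (hl : ∀ t : ℕ, ((N.late α u k t).card : ℝ) ≤ ε * t + D) (t : ℕ) :
    ∑ q ∈ arrivedBefore α t, N.remaining u r k t q
      ≤ N.virtualQueue α u r t + (ε * t + D) * B := by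
  induction t with
  | zero =>
    have : arrivedBefore α 0 = ∅ := by simp [arrivedBefore]
    simp only [this, Finset.sum_empty, EdgeNetwork.virtualQueue, zero_add]
    positivity
  | succ t ih =>
    refine (h.sum_remaining_succ_le hE hstar hB hr k t).trans ?_
    have h1 : N.virtualQueue α u r t - N.cap r + N.arrivingLoad α u r t
      ≤ N.virtualQueue α u r (t + 1) := le_max_left _ _
    have h2 : 0 ≤ N.virtualQueue α u r (t + 1) := le_max_right _ _
    have h3 : (ε * t + D) * B ≤ (ε * (t + 1 : ℕ) + D) * B := by
      push_cast
      gcongr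
      linarith
    have h4 := mul_le_mul_of_nonneg_right (hl t) hB0
    exact max_le (by linarith) (by linarith)

/-- Under nearest-to-origin scheduling, few packets in a queue are partially served. -/
theorem card_partial_le (h : N.Feasible α u) (hE : N.ENTO α u) {r : Resource V}
    (hr : N.HasResource r) (k t : ℕ) :
    ((N.front α u r k t).filter fun x => u.work t x ≠ 0).card ≤ k + 1 := by
  cases t with
  | zero => simp [Control.work]
  | succ t =>
    rw [← Finset.card_range (k + 1)]
    -- A packet that has received work before slot `t + 1` was ready when served, so it was already
    -- queued in slot `t`, and the one-by-one rule of that slot applies to it.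
    have key : ∀ x ∈ (N.front α u r k (t + 1)).filter fun x => u.work (t + 1) x ≠ 0,
        x ∈ N.queue α u t r ∧ 0 < u.work (t + 1) x ∧ ¬ N.Done u (t + 1) x := by
      intro x hx
      obtain ⟨hx, hw⟩ := Finset.mem_filter.1 hx
      obtain ⟨x1, x2, x3, x4, x5⟩ := mem_queue.1 (Finset.mem_filter.1 hx).1
      obtain ⟨s, hs, hne⟩ := Finset.exists_ne_zero_of_sum_ne_zero hw
      have hst : s ≤ t := Nat.lt_succ_iff.1 (Finset.mem_range.1 hs)
      obtain ⟨e, he⟩ := h.queued s x hne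
      obtain ⟨y1, -, -, y4, -⟩ := mem_queue.1 he
      exact ⟨mem_queue.2 ⟨arrived_mono hst y1, x2, x3, h.ready_mono hst y4,
        fun hd => x5 (h.done_mono t.le_succ hd)⟩,
        lt_of_le_of_ne (h.work_nonneg _ _) hw.symm, x5⟩
    -- At most one partially served packet for each of the counts `0, …, k`.
    refine Finset.card_le_card_of_injOn (fun x => (u.route x.1).crossed x.2) ?_ ?_
    · intro x hx
      have := (Finset.mem_filter.1 (Finset.mem_filter.1 hx).1).2
      simp only [Finset.coe_range, Set.mem_Iio]
      omega
    · intro x hx y hy hxy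
      obtain ⟨x1, x2, x3⟩ := key x hx
      obtain ⟨y1, y2, y3⟩ := key y hy
      exact hE.one_by_one t r hr x x1 y y1 hxy x2 x3 y2 y3

/-- An untouched packet still holds its full size, at least `b`, of remaining work; the at most `k +
1` partially served ones may hold arbitrarily little and are discounted. -/
theorem card_front_le (h : N.Feasible α u) (hE : N.ENTO α u) {b : ℝ} (hb0 : 0 ≤ b)
    (hb : ∀ c o, b ≤ N.size c o) {r : Resource V} (hr : N.HasResource r) (k t : ℕ) :
    b * ((N.front α u r k t).card - (k + 1))
      ≤ ∑ q ∈ arrivedBefore α (t + 1), N.remaining u r k t q := by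
  set Z := (N.front α u r k t).filter fun x => ¬ u.work t x ≠ 0 with hZ
  have h1 : ((N.front α u r k t).card : ℝ) - (k + 1) ≤ Z.card := by
    have h2 := Finset.card_filter_add_card_filter_not (s := N.front α u r k t)
      (fun x => u.work t x ≠ 0)
    have h3 := h.card_partial_le hE hr k t
    have h4 : (N.front α u r k t).card ≤ k + 1 + Z.card :=
      h2.symm.le.trans (Nat.add_le_add_right h3 _)
    have h5 : ((N.front α u r k t).card : ℝ) ≤ k + 1 + Z.card := by exact_mod_cast h4
    linarith
  calc b * ((N.front α u r k t).card - (k + 1)) ≤ b * Z.card := by gcongr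
    _ = ∑ x ∈ Z, b := by simp [mul_comm]
    _ ≤ ∑ x ∈ Z, (N.size x.1.client x.2 - u.work t x) := by
      refine Finset.sum_le_sum fun x hx => ?_
      have hw := not_not.1 (Finset.mem_filter.1 hx).2
      rw [hw, sub_zero]
      exact hb _ _
    _ ≤ ∑ x ∈ (u.pairs (arrivedBefore α (t + 1))).filter (fun x =>
          (u.route x.1).site x.2 = some r ∧ (u.route x.1).crossed x.2 ≤ k),
          (N.size x.1.client x.2 - u.work t x) := by
      refine Finset.sum_le_sum_of_subset_of_nonneg (fun y hy => ?_)
        fun x _ _ => sub_nonneg.2 (h.work_le _ _)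
      obtain ⟨hy, hyk⟩ := Finset.mem_filter.1 (Finset.mem_filter.1 hy).1
      obtain ⟨y1, y2, y3, -⟩ := mem_queue.1 hy
      exact Finset.mem_filter.2 ⟨Control.mem_pairs.2 ⟨y1, y2⟩, y3, hyk⟩
    _ = _ := by
      rw [Finset.sum_filter (s := u.pairs _), Control.sum_pairs]
      rfl

theorem sublinear_front (h : N.Feasible α u) (hE : N.ENTO α u)
    (hstar : ∀ q : Request ι, q.index < α q.slot q.client → N.IsStar q.client (u.route q))
    {M : ℕ} (hM : ∀ t c, α t c ≤ M) {r : Resource V} (hr : N.HasResource r)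
    (hv : Sublinear (N.virtualQueue α u r)) {k : ℕ}
    (hl : Sublinear fun t => (N.late α u k t).card) :
    Sublinear fun t => (N.front α u r k t).card := by
  obtain ⟨B, hB0, hB⟩ := N.exists_load_le
  obtain ⟨b, hb0, hb⟩ := N.exists_le_size
  -- `Sublinear` bounds from above only, so this difference may be very negative.
  have h1 : Sublinear fun t => ∑ q ∈ arrivedBefore α t, N.remaining u r k t q
      - N.virtualQueue α u r t := by
    intro ε hε
    obtain ⟨D, hD, hl⟩ := hl (ε / (B + 1)) (by positivity)
    refine ⟨D * B, by positivity, fun t => ?_⟩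
    have h2 := h.sum_remaining_le hE hstar hB0 hB hr (by positivity) hD hl t
    have h3 : ε / (B + 1) * B ≤ ε := by
      rw [div_mul_eq_mul_div, div_le_iff₀ (by positivity)]
      nlinarith
    have h4 : ε / (B + 1) * B * t ≤ ε * t := by gcongr
    linarith
  have h2 := ((h1.add hv).add (Sublinear.const (Fintype.card ι * (M * B)))).const_mul
    (inv_nonneg.2 hb0.le)
  refine (h2.add (Sublinear.const (k + 1))).mono fun t => ?_
  have h3 := h.card_front_le hE hb0.le hb hr k t
  -- The queue of slot `t` already contains the arrivals of slot `t`, which the backlog bound omits;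
  -- they add a bounded amount of work.
  rw [sum_arrivedBefore_succ] at h3
  have h4 : ∑ c, ∑ n ∈ Finset.range (α t c), N.remaining u r k t ⟨t, c, n⟩
      ≤ N.arrivingLoad α u r t :=
    Finset.sum_le_sum fun c _ => Finset.sum_le_sum fun n hn =>
      (h.remaining_le_opLoad r k t _).trans
        ((hstar ⟨t, c, n⟩ (Finset.mem_range.1 hn)).opLoad_le r)
  have h5 := EdgeNetwork.arrivingLoad_le (u := u) hM hB0 hB r t
  rw [← sub_le_iff_le_add, le_inv_mul_iff₀ hb0]
  linarith

/-- A request late for `k + 1` but not for `k` has an unfinished operation of count `k` whose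
predecessors are all finished, so it is in the front of some resource. -/
theorem sublinear_late [Fintype V] (h : N.Feasible α u) (hE : N.ENTO α u)
    (hstar : ∀ q : Request ι, q.index < α q.slot q.client → N.IsStar q.client (u.route q))
    {M : ℕ} (hM : ∀ t c, α t c ≤ M)
    (hv : ∀ r ∈ N.resources, Sublinear (N.virtualQueue α u r)) (k : ℕ) :
    Sublinear fun t => (N.late α u k t).card := by
  induction k with
  | zero =>
    refine (Sublinear.const 0).mono fun t => ?_
    simp [EdgeNetwork.late]
  | succ k ih =>
    refine (ih.add (Sublinear.sum N.resources fun r hr =>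
      h.sublinear_front hE hstar hM (N.mem_resources.1 hr) (hv r hr) ih)).mono fun t => ?_
    have hsub : N.late α u (k + 1) t ⊆ N.late α u k t ∪
        N.resources.biUnion fun r => (N.front α u r k t).image Prod.fst := by
      intro q hq
      obtain ⟨hq, o, ho, hk, hd⟩ := Finset.mem_filter.1 hq
      rw [Finset.mem_union]
      by_cases hl : q ∈ N.late α u k t
      · exact Or.inl hl
      · obtain ⟨r, hr⟩ := Route.exists_site ho
        refine Or.inr (Finset.mem_biUnion.2 ⟨r,
          N.mem_resources.2 ((h.isRoute_of_mem hq).hasResource hr), ?_⟩)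
        exact Finset.mem_image_of_mem Prod.fst
          (mem_front hq hl ho hr (Nat.lt_succ_iff.1 hk) hd)
    have h1 := (Finset.card_le_card hsub).trans ((Finset.card_union_le _ _).trans
      (Nat.add_le_add_left (Finset.card_biUnion_le.trans
        (Finset.sum_le_sum fun r _ => Finset.card_image_le)) _))
    exact_mod_cast h1

/-- Extended nearest-to-origin scheduling of efficient routes makes the actual queues rate stable
if the virtual queues are. -/
theorem rateStable [Fintype V] (h : N.Feasible α u) (hE : N.ENTO α u)
    (hstar : ∀ q : Request ι, q.index < α q.slot q.client → N.IsStar q.client (u.route q))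
    {M : ℕ} (hM : ∀ t c, α t c ≤ M)
    (hv : ∀ r ∈ N.resources, Sublinear (N.virtualQueue α u r)) : N.RateStable α u := by
  -- Beyond all counts of efficient routes: the front is now the whole queue, and late means
  -- undelivered.
  set k := 2 * Fintype.card V + 3
  have hcr : ∀ {t : ℕ} {q : Request ι} {o : Operation}, q ∈ arrived α t →
      o ∈ (u.route q).operations → (u.route q).crossed o < k := by
    intro t q o hq ho
    have hs := hstar q (mem_arrived.1 hq).2
    exact Route.crossed_lt_of_mem hs.live_nodup hs.stat_nodup hs.output_nodup ho
  have hl := h.sublinear_late hE hstar hM hv k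
  have hqueue : ∀ r, N.HasResource r →
      Tendsto (fun t : ℕ => ((N.queue α u t r).card : ℝ) / t) atTop (𝓝 0) := by
    intro r hr
    refine Sublinear.tendsto ?_ fun t => Nat.cast_nonneg _
    refine (h.sublinear_front hE hstar hM hr (hv r (N.mem_resources.2 hr)) hl).mono fun t => ?_
    have : N.queue α u t r ⊆ N.front α u r k t := fun x hx => by
      obtain ⟨x1, x2, -⟩ := mem_queue.1 hx
      exact Finset.mem_filter.2 ⟨hx, (hcr x1 x2).le⟩
    exact_mod_cast Finset.card_le_card this
  refine ⟨fun i => hqueue _ trivial, fun i => ?_, fun e he => hqueue _ he⟩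
  refine Sublinear.tendsto (hl.mono fun t => ?_) fun t => Nat.cast_nonneg _
  -- A waiting packet's associate has an unfinished transmission.
  have : N.waiting α u t i ⊆ N.late α u k t := fun q hq => by
    obtain ⟨hq, -, hx⟩ := Finset.mem_filter.1 hq
    have hex : ∃ o ∈ (u.route q).operations, ¬ N.Done u t (q, o) := by
      rcases hx with ⟨-, hx⟩ | ⟨-, hx⟩
      · simp only [EdgeNetwork.StatThere, not_forall] at hx
        obtain ⟨j, hj, hd⟩ := hx
        exact ⟨.stat j, (Route.mem_operations _ _).2 hj, hd⟩
      · simp only [EdgeNetwork.LiveThere, not_forall] at hx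
        obtain ⟨j, hj, hd⟩ := hx
        exact ⟨.live j, (Route.mem_operations _ _).2 hj, hd⟩
    obtain ⟨o, ho, hd⟩ := hex
    exact Finset.mem_filter.2 ⟨hq, o, ho, hcr hq ho, hd⟩
  exact_mod_cast Finset.card_le_card this

end EdgeNetwork.Feasible

end NearestToOrigin

/-! ### Min-weight routing stabilizes the virtual queues, and the conclusion -/

section Main

variable {V K Φ ι : Type*}

/-- The arrival rates are almost surely the limits of the averages of the arrivals. -/
theorem IsArrivalProcess.tendsto_average [Finite ι] {Ω : Type*} [MeasurableSpace Ω]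
    {P : Measure Ω} [IsProbabilityMeasure P] {a : ℕ → ι → Ω → ℕ} {lam : ι → ℝ}
    (ha : IsArrivalProcess P a lam) :
    ∀ᵐ ω ∂P, ∀ c, Tendsto (fun T : ℕ => (∑ t ∈ Finset.range T, (a t c ω : ℝ)) / T) atTop
      (𝓝 (lam c)) := by
  rw [ae_all_iff]
  intro c
  have hcast : Measurable (fun n : ℕ => (n : ℝ)) := measurable_from_nat
  obtain ⟨M, hM⟩ := ha.bounded
  have hint : Integrable (fun ω => (a 0 c ω : ℝ)) P := by
    refine Integrable.of_bound (hcast.comp (ha.measurable 0 c)).aestronglyMeasurable M ?_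
    filter_upwards [hM 0 c] with ω hω
    rw [Real.norm_natCast]
    exact_mod_cast hω
  rw [← ha.mean c]
  exact strong_law_ae_real (fun t ω => (a t c ω : ℝ)) hint
    (fun i j hij => ((ha.indep c).indepFun hij).comp hcast hcast)
    (fun t => (ha.identDistrib t c).comp hcast)

variable [Fintype ι] {N : EdgeNetwork V K Φ ι}

theorem EdgeNetwork.virtualQueue_nonneg (α : ℕ → ι → ℕ) (u : Control V ι) (r : Resource V)
    (t : ℕ) : 0 ≤ N.virtualQueue α u r t := by
  cases t with
  | zero => exact le_rfl
  | succ t => exact le_max_right _ _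

variable [Fintype V]

/-- The weight is the cost of a route at the prices `Q̃ / cap²`, up to a factor the gradient of the
Lyapunov function. -/
theorem EdgeNetwork.weight_eq (α : ℕ → ι → ℕ) (u : Control V ι) (t : ℕ) (c : ι) (σ : Route V) :
    N.weight α u t c σ
      = ∑ r ∈ N.resources, N.virtualQueue α u r t / N.cap r / N.cap r * N.load c σ r := by
  rw [N.sum_resources]
  simp only [EdgeNetwork.weight, EdgeNetwork.normQueue, EdgeNetwork.cap, mul_comm]

/-- For arrival rates in the stability region, no prices of the resources make the cheapest routes
of the arrivals cost more than all the capacity. -/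
theorem EdgeNetwork.sum_weight_le_of_mem_stabilityRegion {lam : ι → ℝ}
    (hlam : lam ∈ N.stabilityRegion) {w : Resource V → ℝ} (hw : ∀ r ∈ N.resources, 0 ≤ w r)
    {m : ι → ℝ} (hm : ∀ c τ, N.IsStar c τ → m c ≤ ∑ r ∈ N.resources, w r * N.load c τ r) :
    ∑ c, lam c * m c ≤ ∑ r ∈ N.resources, w r * N.cap r := by
  obtain ⟨Ω, _, P, _, a, seed, π, ha, -, -, hs⟩ := hlam
  -- The inequality is deterministic, so a single good sample path of the stabilizing policy
  -- suffices, even though it lives on another probability space.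
  obtain ⟨ω, h1, h2⟩ := (hs.and ha.tendsto_average).exists
  exact h1.sum_price_le (π.feasible _ _) h2 hw hm

/-- Minimum weight routing makes the virtual queues rate stable. -/
theorem EdgeNetwork.MinWeightRouting.tendsto_virtualQueue {α : ℕ → ι → ℕ} {u : Control V ι}
    (hR : N.MinWeightRouting α u) {M : ℕ} (hM : ∀ t c, α t c ≤ M) {lam : ι → ℝ}
    (hα : ∀ c, Tendsto (fun T : ℕ => (∑ t ∈ Finset.range T, (α t c : ℝ)) / T) atTop (𝓝 (lam c)))
    (hlam : lam ∈ N.stabilityRegion) :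
    ∀ r ∈ N.resources, Tendsto (fun T : ℕ => N.virtualQueue α u r T / T) atTop (𝓝 0) := by
  choose σ hσ hmin hroute using hR
  obtain ⟨B, hB0, hB⟩ := N.exists_load_le
  set A : ℝ := Fintype.card ι * (M * B) with hA
  have hA0 : 0 ≤ A := by positivity
  have haB := EdgeNetwork.arrivingLoad_le (N := N) (u := u) hM hB0 hB
  have ha0 := EdgeNetwork.arrivingLoad_nonneg (N := N) (α := α) (u := u)
  have hcap : ∀ r ∈ N.resources, 0 < N.cap r := fun r hr => N.cap_pos (N.mem_resources.1 hr)
  have hQ : ∀ r t, N.virtualQueue α u r (t + 1)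
      = max (N.virtualQueue α u r t - N.cap r + N.arrivingLoad α u r t) 0 := fun _ _ => rfl
  have hstep : ∀ r ∈ N.resources, ∀ t,
      |N.virtualQueue α u r (t + 1) - N.virtualQueue α u r t| ≤ A + N.cap r := by
    intro r hr t
    have h1 := N.virtualQueue_nonneg α u r t
    have h2 := hcap r hr
    have h3 := ha0 r t
    have h4 := haB r t
    rw [hQ, abs_le]
    constructor
    · linarith [le_max_left (N.virtualQueue α u r t - N.cap r + N.arrivingLoad α u r t) 0]
    · rw [sub_le_iff_le_add]
      exact max_le (by linarith) (by linarith)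
  set L : ℝ := ∑ r ∈ N.resources, (A + N.cap r) / N.cap r / N.cap r * B with hL
  have hlip : ∀ t c τ, |N.weight α u (t + 1) c τ - N.weight α u t c τ| ≤ L := by
    intro t c τ
    rw [EdgeNetwork.weight_eq, EdgeNetwork.weight_eq, ← Finset.sum_sub_distrib]
    refine (Finset.abs_sum_le_sum_abs _ _).trans (Finset.sum_le_sum fun r hr => ?_)
    have hc := hcap r hr
    rw [← sub_mul, ← sub_div, ← sub_div, abs_mul, abs_div, abs_div, abs_of_pos hc,
      abs_of_nonneg (N.load_nonneg c τ r)]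
    gcongr
    · exact N.load_nonneg c τ r
    · exact hstep r hr t
    · exact hB c τ r
  refine tendsto_queue_div (m := fun t c => N.weight α u t c (σ t c)) (L := L) (B := A) hcap
    ha0 haB (fun _ => rfl) hQ hα ?_ ?_ ?_ ?_
  · intro c
    rw [EdgeNetwork.weight_eq]
    simp [EdgeNetwork.virtualQueue]
  -- A minimum of `L`-Lipschitz functions is `L`-Lipschitz: each slot's minimizer is tested in the
  -- other slot.
  · intro t c
    rw [abs_le]
    have h1 := abs_le.1 (hlip t c (σ t c))
    have h2 := abs_le.1 (hlip t c (σ (t + 1) c))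
    have h3 := hmin t c _ (hσ (t + 1) c)
    have h4 := hmin (t + 1) c _ (hσ t c)
    constructor <;> linarith
  · intro t
    refine le_of_eq ?_
    have h1 : ∀ r, N.arrivingLoad α u r t = ∑ c, α t c * N.load c (σ t c) r := by
      intro r
      refine Finset.sum_congr rfl fun c _ => ?_
      rw [Finset.sum_congr rfl fun n hn => by
        rw [hroute t c n (Finset.mem_range.1 hn)]]
      simp
    simp only [h1, EdgeNetwork.weight_eq, Finset.mul_sum]
    rw [Finset.sum_comm]
    exact Finset.sum_congr rfl fun c _ => Finset.sum_congr rfl fun r _ => by ring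
  · intro t
    refine EdgeNetwork.sum_weight_le_of_mem_stabilityRegion hlam
      (w := fun r => N.virtualQueue α u r t / N.cap r / N.cap r) (fun r hr => ?_) fun c τ hτ => ?_
    · have h1 := N.virtualQueue_nonneg α u r t
      have h2 := hcap r hr
      positivity
    · rw [← EdgeNetwork.weight_eq]
      exact hmin t c τ hτ

end Main

/-- Stability holds on every path with bounded arrivals and convergent averages, whatever the value
of the seed, so the seed may depend on the arrivals in any way. -/
theorem theorem2 {V K Φ ι : Type*} [Fintype V] [Fintype ι] (N : EdgeNetwork V K Φ ι)
    {Ω : Type*} [MeasurableSpace Ω] (P : Measure Ω) [IsProbabilityMeasure P]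
    (a : ℕ → ι → Ω → ℕ) (lam : ι → ℝ) (ha : IsArrivalProcess P a lam)
    (hlam : lam ∈ N.stabilityRegion)
    (π : Policy N) (hπ : π.IsDIDCNC) (seed : Ω → ℝ) :
    ∀ᵐ ω ∂P, N.RateStable (fun t c => a t c ω)
      (π.control (seed ω) (fun t c => a t c ω)) := by
  obtain ⟨M, hM⟩ := ha.bounded
  filter_upwards [ha.tendsto_average, ae_all_iff.2 fun t => ae_all_iff.2 fun c => hM t c]
    with ω h1 h2
  obtain ⟨hR, hE⟩ := hπ (seed ω) (fun t c => a t c ω)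
  refine (π.feasible _ _).rateStable hE (fun q hq => ?_) h2 fun r hr =>
    Sublinear.of_tendsto (hR.tendsto_virtualQueue h2 h1 hlam r hr)
  obtain ⟨σ, hσ, -, hroute⟩ := hR q.slot q.client
  exact (hroute q.index hq) ▸ hσ
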